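/- Fix $N$ and $n\ge 3$, and put $q=N(N+1)/2$. Let $P_k$ be the set of real symmetric positive-definite $k\times k$ matrices, $\|\cdot\|$ the Frobenius norm (or the Euclidean norm of vectors), and $\exp,\log$ the matrix exponential and the matrix logarithm. For $X\in P_N$ with $\log X=(y_{ij})$ let $\widetilde X=(y_{11},\dots,y_{NN},(\sqrt2\,y_{ij})_{i<j})^T\in\mathbb R^q$, and for $X,Y\in P_N$ let $d_{LE}(X,Y)=\|\log X-\log Y\|$. For $M\in P_N$ and $\Sigma\in P_q$, a $P_N$-valued random variable $X$ has the law $LN(M,\Sigma)$ if $\widetilde X\sim N(\widetilde M,\Sigma)$. Let $(M_i)_{i\ge1}$ in $P_N$ and $(\Sigma_i)_{i\ge1}$ in $P_q$ be fixed (deterministic) sequences, and let $X_{ij}\sim LN(M_i,\Sigma_i)$, $i\ge 1$, $1\le j\le n$, be independent. Put $$\bar X_i=\exp\Big(\tfrac1n\sum_{j=1}^n\log X_{ij}\Big),\qquad S_i=\sum_{j=1}^n\big(\widetilde X_{ij}-\widetilde{\bar X_i}\big)\big(\widetilde X_{ij}-\widetilde{\bar X_i}\big)^T .$$ For $\lambda>0$,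 $\nu>q+1$, $\Psi\in P_q$, $\mu\in P_N$ define the estimators $$\widehat M_i^{\lambda,\mu}=\exp\Big(\frac{n\log\bar X_i+\lambda\log\mu}{\lambda+n}\Big),\qquad \widehat\Sigma_i^{\Psi,\nu}=\frac{\Psi+S_i}{\nu+n-q-2},$$ the loss $$L=\frac1p\sum_{i=1}^p d_{LE}^2\big(\widehat M_i^{\lambda,\mu},M_i\big)+\frac1p\sum_{i=1}^p\big\|\widehat\Sigma_i^{\Psi,\nu}-\Sigma_i\big\|^2,$$ and $$\begin{aligned}\mathrm{SURE}(\lambda,\Psi,\nu,\mu)=\frac1p\sum_{i=1}^p\Big\{&(\lambda+n)^{-2}\Big[\frac{n-\lambda^2/n}{n-1}\operatorname{tr}S_i+\lambda^2d_{LE}^2(\bar X_i,\mu)\Big]\\ &+(\nu+n-q-2)^{-2}\Big[\frac{n-3+(\nu-q-1)^2}{(n+1)(n-2)}\operatorname{tr}(S_i^2)+\frac{(n-1)^2-(\nu-q-1)^2}{(n-1)(n+1)(n-2)}(\operatorname{tr}S_i)^2\\ &\qquad-2\,\frac{\nu-q-1}{n-1}\operatorname{tr}(\Psi S_i)+\operatorname{tr}(\Psi^2)\Big]\Big\}.\end{aligned}$$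 Assume (i) $\limsup_{p\to\infty}p^{-1}\sum_{i=1}^p(\operatorname{tr}\Sigma_i)^4<\infty$; (ii) $\limsup_{p\to\infty}p^{-1}\sum_{i=1}^p\widetilde M_i^T\Sigma_i\widetilde M_i<\infty$; (iii) $\limsup_{p\to\infty}p^{-1}\sum_{i=1}^p\|\log M_i\|^{2+\delta}<\infty$ for some $\delta>0$. Then $$\sup\big|\mathrm{SURE}(\lambda,\Psi,\nu,\mu)-L\big|\longrightarrow0\quad\text{in probability as }p\to\infty,$$ where the supremum is over all $\lambda>0$, $\nu>q+1$, $\Psi\in P_q$ with $\|\Psi\|\le\max_{1\le i\le p}\|S_i\|$, and $\mu\in P_N$ with $\|\log\mu\|\le\max_{1\le i\le p}\|\log\bar X_i\|$. -/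

import Mathlib

open MeasureTheory ProbabilityTheory Filter Topology Matrix
open scoped ENNReal

/-- The space of real symmetric positive-definite matrices with rows and columns indexed by `ι`. -/
abbrev SPD (ι : Type*) : Type _ := {A : Matrix ι ι ℝ // A.PosDef}

/-- The product σ-algebra on real matrices (all entries are measurable). -/
instance matrixMeasurableSpace (ι κ : Type*) : MeasurableSpace (Matrix ι κ ℝ) :=
  inferInstanceAs (MeasurableSpace (ι → κ → ℝ))

/-- On finite matrices the product σ-algebra is the Borel σ-algebra. -/
instance matrixBorelSpace (ι κ : Type*) [Countable ι] [Countable κ] :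
    BorelSpace (Matrix ι κ ℝ) :=
  inferInstanceAs (BorelSpace (ι → κ → ℝ))

/-- Index set of the vectorisation of symmetric `N × N` matrices: first the diagonal positions,
then the positions strictly above the diagonal. -/
abbrev SymIdx (N : ℕ) : Type := Fin N ⊕ {ij : Fin N × Fin N // ij.1 < ij.2}

/-- The dimension `q = N (N + 1) / 2` of the space of symmetric `N × N` matrices. -/
noncomputable def symDim (N : ℕ) : ℝ := (N : ℝ) * ((N : ℝ) + 1) / 2

open scoped Matrix.Norms.Frobenius in
/-- The Frobenius norm. -/
noncomputable def frobNorm {ι : Type*} [Fintype ι] (A : Matrix ι ι ℝ) : ℝ := ‖A‖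

/-- The vectorisation `(y₁₁, …, y_NN, (√2 y_ij)_{i<j})` of a symmetric matrix. -/
noncomputable def vecSym {N : ℕ} (Y : Matrix (Fin N) (Fin N) ℝ) : EuclideanSpace ℝ (SymIdx N) :=
  WithLp.toLp 2 (Sum.elim (fun i => Y i i) (fun ij => Real.sqrt 2 * Y ij.1.1 ij.1.2))

/-- The matrix logarithm (functional calculus of a real symmetric matrix). -/
noncomputable def matLog {N : ℕ} (X : Matrix (Fin N) (Fin N) ℝ) : Matrix (Fin N) (Fin N) ℝ :=
  cfc Real.log X

/-- The matrix exponential. -/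
noncomputable def matExp {N : ℕ} (Y : Matrix (Fin N) (Fin N) ℝ) : Matrix (Fin N) (Fin N) ℝ :=
  NormedSpace.exp Y

/-- `X̃ = vec (log X)`. -/
noncomputable def tildeVec {N : ℕ} (X : Matrix (Fin N) (Fin N) ℝ) : EuclideanSpace ℝ (SymIdx N) :=
  vecSym (matLog X)

/-- The Log-Euclidean distance. -/
noncomputable def distLE {N : ℕ} (X Y : Matrix (Fin N) (Fin N) ℝ) : ℝ :=
  frobNorm (matLog X - matLog Y)

/-- `X ∼ LN(M, Σ)`: `X` is an SPD-valued random variable and `vec (log X)` has the Gaussian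
law with mean `vec (log M)` and covariance `Σ`. -/
structure IsLogNormal {Ω : Type*} [MeasurableSpace Ω] (P : Measure Ω) {N : ℕ}
    (X : Ω → SPD (Fin N)) (M : SPD (Fin N)) (Sig : SPD (SymIdx N)) : Prop where
  measurable : Measurable X
  hasLaw : HasLaw (fun ω => tildeVec (X ω).1) (multivariateGaussian (tildeVec M.1) Sig.1) P

/-- The sample Fréchet mean `X̄ = exp (n⁻¹ ∑ⱼ log Xⱼ)` for the Log-Euclidean distance. -/
noncomputable def sampleFM {N n : ℕ} (x : Fin n → SPD (Fin N)) : Matrix (Fin N) (Fin N) ℝ :=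
  matExp ((n : ℝ)⁻¹ • ∑ j, matLog (x j).1)

/-- The scatter matrix `S = ∑ⱼ (X̃ⱼ - X̄~) (X̃ⱼ - X̄~)ᵀ`. -/
noncomputable def scatter {N n : ℕ} (x : Fin n → SPD (Fin N)) :
    Matrix (SymIdx N) (SymIdx N) ℝ :=
  ∑ j, Matrix.vecMulVec (tildeVec (x j).1 - tildeVec (sampleFM x)).ofLp
    (tildeVec (x j).1 - tildeVec (sampleFM x)).ofLp

/-- The shrinkage estimator `exp ((n log X̄ + lam log mu) / (lam + n))` of the mean. -/
noncomputable def shrinkMean {N n : ℕ} (lam : ℝ) (mu : SPD (Fin N)) (x : Fin n → SPD (Fin N)) :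
    Matrix (Fin N) (Fin N) ℝ :=
  matExp ((lam + n)⁻¹ • ((n : ℝ) • matLog (sampleFM x) + lam • matLog mu.1))

/-- The shrinkage estimator `(Psi + S) / (nu + n - q - 2)` of the covariance. -/
noncomputable def shrinkCov {N n : ℕ} (Psi : SPD (SymIdx N)) (nu : ℝ) (x : Fin n → SPD (Fin N)) :
    Matrix (SymIdx N) (SymIdx N) ℝ :=
  (nu + n - symDim N - 2)⁻¹ • (Psi.1 + scatter x)

/-- The loss `p⁻¹ ∑ᵢ d_LE²(M̂ᵢ, Mᵢ) + p⁻¹ ∑ᵢ ‖Σ̂ᵢ - Σᵢ‖²`. -/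
noncomputable def totalLoss {N : ℕ} (p : ℕ) (Mhat : ℕ → Matrix (Fin N) (Fin N) ℝ)
    (Sighat : ℕ → Matrix (SymIdx N) (SymIdx N) ℝ)
    (M : ℕ → SPD (Fin N)) (Sig : ℕ → SPD (SymIdx N)) : ℝ :=
  (p : ℝ)⁻¹ * ∑ i ∈ Finset.range p, distLE (Mhat i) (M i).1 ^ 2
    + (p : ℝ)⁻¹ * ∑ i ∈ Finset.range p, frobNorm (Sighat i - (Sig i).1) ^ 2

/-- Stein's unbiased risk estimate, computed from the data `x i j` (`i < p`, `j < n`). -/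
noncomputable def sure {N n : ℕ} (p : ℕ) (x : ℕ → Fin n → SPD (Fin N))
    (lam : ℝ) (Psi : SPD (SymIdx N)) (nu : ℝ) (mu : SPD (Fin N)) : ℝ :=
  (p : ℝ)⁻¹ * ∑ i ∈ Finset.range p,
    (((lam + n) ^ 2)⁻¹ *
        (((n : ℝ) - lam ^ 2 / n) / ((n : ℝ) - 1) * (scatter (x i)).trace
          + lam ^ 2 * distLE (sampleFM (x i)) mu.1 ^ 2)
      + ((nu + n - symDim N - 2) ^ 2)⁻¹ *
        (((n : ℝ) - 3 + (nu - symDim N - 1) ^ 2) / (((n : ℝ) + 1) * ((n : ℝ) - 2))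
            * (scatter (x i) * scatter (x i)).trace
          + (((n : ℝ) - 1) ^ 2 - (nu - symDim N - 1) ^ 2)
              / (((n : ℝ) - 1) * ((n : ℝ) + 1) * ((n : ℝ) - 2)) * (scatter (x i)).trace ^ 2
          - 2 * ((nu - symDim N - 1) / ((n : ℝ) - 1)) * (Psi.1 * scatter (x i)).trace
          + (Psi.1 * Psi.1).trace))

/-- The supremum of `|SURE - L|` over all `lam > 0`, `nu > q + 1`, SPD matrices `Psi` with
`‖Psi‖ ≤ maxᵢ ‖Sᵢ‖` and SPD matrices `mu` with `‖log mu‖ ≤ maxᵢ ‖log X̄ᵢ‖`, as an element of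
`[0, ∞]`. -/
noncomputable def supGap {N n : ℕ} (p : ℕ) (x : ℕ → Fin n → SPD (Fin N))
    (M : ℕ → SPD (Fin N)) (Sig : ℕ → SPD (SymIdx N)) : ℝ≥0∞ :=
  ⨆ (lam : ℝ) (Psi : SPD (SymIdx N)) (nu : ℝ) (mu : SPD (Fin N))
    (_ : 0 < lam) (_ : symDim N + 1 < nu)
    (_ : frobNorm Psi.1 ≤ ⨆ i : Fin p, frobNorm (scatter (x i)))
    (_ : frobNorm (matLog mu.1) ≤ ⨆ i : Fin p, frobNorm (matLog (sampleFM (x i)))),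
    ENNReal.ofReal |sure p x lam Psi nu mu
      - totalLoss p (fun i => shrinkMean lam mu (x i)) (fun i => shrinkCov Psi nu (x i)) M Sig|

/-!
The gap `SURE - L` is, for every choice of the hyperparameters, a linear combination of averages
over `i < p` of finitely many centred statistics of the `i`-th sample, namely those collected in
`gapStat`. In terms of the vectors `X̃ᵢⱼ` (with sample mean `smean`, scatter matrix `scat` and true
mean `m`) these are the errors of the unbiased estimates of `‖smean - m‖²`, `‖S - (n - 1) Σ‖²` and
`‖Σ‖²`, the inner products `⟨smean - m, m⟩` and `⟨Σ, S - (n - 1) Σ⟩`, and the entries of `smean - m`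
and of `S - (n - 1) Σ`. The identity is `sure_sub_totalLoss`. Its coefficients are bounded by
absolute constants, except those of the last two kinds, which are the entries of `log μ` and of
`Ψ`, and these are bounded by `maxᵢ ‖log X̄ᵢ‖` and `maxᵢ ‖Sᵢ‖`.

That the statistics are centred is a computation with the second moments of a Wishart matrix
(`IsGaussianSample.integral_scat_mul`). It follows from Isserlis' formula for linear forms of the
Gaussian sample, and the formula from the fourth moment of a real Gaussian variable by polarisation
(`IsGaussianFamily.integral_mul_mul_mul`). Their second moments are at most a constant times
`1 + (tr Σᵢ)⁴ + m̃ᵢᵀ Σᵢ m̃ᵢ` (`exists_integral_gapStat_sq_le`), so by independence the averages have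
second moments of order `1 / p` under the hypotheses on `Σᵢ` and `Mᵢ`.

The two maxima grow more slowly than `√p`. Both are controlled by `maxᵢ Rᵢ`, where
`Rᵢ = ∑ⱼ ‖X̃ᵢⱼ - mᵢ‖²` is the `energy`, together with the deterministic `maxᵢ ‖log Mᵢ‖`. As
`E Rᵢ⁴ ≤ C (tr Σᵢ)⁴`, the former is of order `p ^ (1 / 4)`; the latter is of order
`p ^ (1 / (2 + δ))`. Young's inequality separates the maxima from the averages and gives a bound
for the supremum of the gap (`exists_supGap_le`) whose expectation tends to `0`; Markov's
inequality concludes.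

The independence of the vectors `X̃ᵢⱼ` requires the matrix logarithm to be measurable, which is
`measurable_matLog`.
-/

/-! ### Random variables with finite moments of every order -/

/-- `f` has finite absolute moments of every order. -/
def HasAllMoments {Ω : Type*} [MeasurableSpace Ω] (f : Ω → ℝ) (P : Measure Ω) : Prop :=
  ∀ p : NNReal, MemLp f p P

namespace HasAllMoments

variable {Ω : Type*} [MeasurableSpace Ω] {P : Measure Ω} {f g : Ω → ℝ}

lemma const [IsFiniteMeasure P] (c : ℝ) : HasAllMoments (fun _ => c) P :=
  fun _ => memLp_const c

lemma add (hf : HasAllMoments f P) (hg : HasAllMoments g P) :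
    HasAllMoments (fun ω => f ω + g ω) P :=
  fun p => (hf p).add (hg p)

lemma sub (hf : HasAllMoments f P) (hg : HasAllMoments g P) :
    HasAllMoments (fun ω => f ω - g ω) P :=
  fun p => (hf p).sub (hg p)

lemma mul (hf : HasAllMoments f P) (hg : HasAllMoments g P) :
    HasAllMoments (fun ω => f ω * g ω) P := by
  intro p
  have h2 : ENNReal.HolderTriple ((2 * p : NNReal) : ℝ≥0∞) ((2 * p : NNReal) : ℝ≥0∞) p := by
    constructor
    rw [ENNReal.coe_mul, ENNReal.mul_inv (Or.inr (by simp)) (Or.inl (by simp)), ← add_mul]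
    simp [ENNReal.inv_two_add_inv_two]
  exact (hg (2 * p)).mul (hf (2 * p))

lemma const_mul (c : ℝ) (hf : HasAllMoments f P) : HasAllMoments (fun ω => c * f ω) P :=
  fun p => (hf p).const_mul c

lemma div_const (hf : HasAllMoments f P) (c : ℝ) : HasAllMoments (fun ω => f ω / c) P := by
  simpa [div_eq_inv_mul] using hf.const_mul c⁻¹

lemma pow [IsFiniteMeasure P] (hf : HasAllMoments f P) (k : ℕ) :
    HasAllMoments (fun ω => f ω ^ k) P := by
  induction k with
  | zero => simpa using const 1
  | succ k ih => simpa [pow_succ] using ih.mul hf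

lemma sum {κ : Type*} (s : Finset κ) {F : κ → Ω → ℝ} (hF : ∀ k ∈ s, HasAllMoments (F k) P) :
    HasAllMoments (fun ω => ∑ k ∈ s, F k ω) P :=
  fun p => memLp_finsetSum s fun k hk => hF k hk p

lemma integrable (hf : HasAllMoments f P) : Integrable f P :=
  memLp_one_iff_integrable.1 (by simpa using hf 1)

lemma memLp_two (hf : HasAllMoments f P) : MemLp f 2 P := by simpa using hf 2

end HasAllMoments

/-! ### Moments of Gaussian random variables -/

/-- The fourth derivative at `0` of the moment generating function `exp (v t² / 2)` is `3 v²`. -/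
lemma integral_pow_four_gaussianReal (v : NNReal) :
    ∫ x, x ^ 4 ∂(gaussianReal 0 v) = 3 * (v : ℝ) ^ 2 := by
  have h0 : ∫ x, x ^ 4 ∂(gaussianReal 0 v)
      = iteratedDeriv 4 (mgf (fun x ↦ x) (gaussianReal 0 v)) 0 := by
    rw [iteratedDeriv_mgf_zero] <;> simp
  rw [h0, mgf_fun_id_gaussianReal]
  have hE : ∀ t : ℝ, HasDerivAt (fun t : ℝ => Real.exp (0 * t + v * t ^ 2 / 2))
      (v * t * Real.exp (0 * t + v * t ^ 2 / 2)) t := by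
    intro t
    have h1 : HasDerivAt (fun t : ℝ => 0 * t + (v : ℝ) * t ^ 2 / 2) (v * t) t := by
      have := ((hasDerivAt_id t).const_mul 0).add
        ((((hasDerivAt_id t).pow 2).const_mul (v : ℝ)).div_const 2)
      refine this.congr_deriv ?_
      simp; ring
    refine h1.exp.congr_deriv (by ring)
  have step : ∀ (p p' : ℝ → ℝ), (∀ t, HasDerivAt p (p' t) t) →
      deriv (fun t => p t * Real.exp (0 * t + v * t ^ 2 / 2))
        = fun t => (p' t + v * t * p t) * Real.exp (0 * t + v * t ^ 2 / 2) := by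
    intro p p' hp
    funext t
    exact (((hp t).mul (hE t)).congr_deriv (by ring)).deriv
  have e1 : deriv (fun t : ℝ => Real.exp (0 * t + v * t ^ 2 / 2))
      = fun t => (v * t) * Real.exp (0 * t + v * t ^ 2 / 2) := funext fun t => (hE t).deriv
  have hp1 : ∀ t : ℝ, HasDerivAt (fun t : ℝ => (v : ℝ) * t) (v : ℝ) t := fun t => by
    simpa using (hasDerivAt_id t).const_mul (v : ℝ)
  have hp2 : ∀ t : ℝ, HasDerivAt (fun t : ℝ => (v : ℝ) + v * t * (v * t)) (2 * v ^ 2 * t) t :=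
    fun t => (((hp1 t).mul (hp1 t)).const_add (v : ℝ)).congr_deriv (by ring)
  have hp3 : ∀ t : ℝ, HasDerivAt
      (fun t : ℝ => 2 * (v : ℝ) ^ 2 * t + v * t * (v + v * t * (v * t)))
      (2 * (v : ℝ) ^ 2 + ((v : ℝ) * (v + v * t * (v * t)) + v * t * (2 * v ^ 2 * t))) t := fun t =>
    ((by simpa using (hasDerivAt_id t).const_mul (2 * (v : ℝ) ^ 2) :
      HasDerivAt (fun t : ℝ => 2 * (v : ℝ) ^ 2 * t) (2 * (v : ℝ) ^ 2) t).add
      ((hp1 t).mul (hp2 t)))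
  rw [iteratedDeriv_succ', iteratedDeriv_succ', iteratedDeriv_succ', iteratedDeriv_one,
    e1, step _ _ hp1, step _ _ hp2, step _ _ hp3]
  simp
  ring

/-- By scaling, the eighth moment of a centred Gaussian variable is a constant times the fourth
power of the variance. -/
lemma integral_pow_eight_gaussianReal (v : NNReal) :
    ∫ x, x ^ 8 ∂(gaussianReal 0 v) = (∫ x, x ^ 8 ∂(gaussianReal 0 1)) * (v : ℝ) ^ 4 := by
  have h : (gaussianReal 0 1).map (fun x => Real.sqrt v * x) = gaussianReal 0 v := by
    rw [gaussianReal_map_const_mul]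
    congr 1
    · simp
    · ext; simp
  rw [← h, integral_map (by fun_prop) (by fun_prop), ← integral_mul_const]
  congr 1
  funext x
  have h8 : Real.sqrt v ^ 8 = (v : ℝ) ^ 4 := by
    rw [show (8 : ℕ) = 2 * 4 by norm_num, pow_mul, Real.sq_sqrt v.coe_nonneg]
  rw [mul_pow, h8, mul_comm]

section GaussianFamily

variable {Ω : Type*} [MeasurableSpace Ω] {P : Measure Ω}

lemma HasAllMoments.of_gaussian {f : Ω → ℝ} {v : NNReal} (hf : HasLaw f (gaussianReal 0 v) P) :
    HasAllMoments f P := by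
  intro p
  have h := memLp_id_gaussianReal (μ := 0) (v := v) p
  rw [← hf.map_eq] at h
  exact (memLp_map_measure_iff h.aestronglyMeasurable hf.aemeasurable).1 h

lemma integral_comp_of_hasLaw {f : Ω → ℝ} {v : NNReal} (hf : HasLaw f (gaussianReal 0 v) P)
    (k : ℕ) : ∫ ω, f ω ^ k ∂P = ∫ x, x ^ k ∂(gaussianReal 0 v) := by
  rw [← hf.map_eq, integral_map hf.aemeasurable (by fun_prop)]

/-- A linear family `L` of centred Gaussian variables with covariance form `B`. -/
structure IsGaussianFamily {V : Type*} [AddCommGroup V] [Module ℝ V] (L : V →ₗ[ℝ] (Ω → ℝ))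
    (B : V →ₗ[ℝ] V →ₗ[ℝ] ℝ) (P : Measure Ω) : Prop where
  symm : ∀ a b, B a b = B b a
  nonneg : ∀ a, 0 ≤ B a a
  law : ∀ a, HasLaw (L a) (gaussianReal 0 (B a a).toNNReal) P

namespace IsGaussianFamily

variable {V : Type*} [AddCommGroup V] [Module ℝ V] {L : V →ₗ[ℝ] (Ω → ℝ)}
  {B : V →ₗ[ℝ] V →ₗ[ℝ] ℝ}

lemma hasAllMoments (h : IsGaussianFamily L B P) (a : V) : HasAllMoments (L a) P :=
  .of_gaussian (h.law a)

lemma integral_eq_zero (h : IsGaussianFamily L B P) (a : V) : ∫ ω, L a ω ∂P = 0 := by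
  simpa using integral_comp_of_hasLaw (h.law a) 1

lemma integral_sq (h : IsGaussianFamily L B P) (a : V) : ∫ ω, L a ω ^ 2 ∂P = B a a := by
  rw [integral_comp_of_hasLaw (h.law a) 2]
  have h1 := variance_fun_id_gaussianReal (μ := 0) (v := (B a a).toNNReal)
  rw [variance_eq_integral measurable_id'.aemeasurable] at h1
  simpa [h.nonneg a] using h1

lemma integral_pow_four (h : IsGaussianFamily L B P) (a : V) :
    ∫ ω, L a ω ^ 4 ∂P = 3 * B a a ^ 2 := by
  rw [integral_comp_of_hasLaw (h.law a) 4, integral_pow_four_gaussianReal,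
    Real.coe_toNNReal _ (h.nonneg a)]

lemma integral_pow_eight (h : IsGaussianFamily L B P) (a : V) :
    ∫ ω, L a ω ^ 8 ∂P = (∫ x, x ^ 8 ∂(gaussianReal 0 1)) * B a a ^ 4 := by
  rw [integral_comp_of_hasLaw (h.law a) 8, integral_pow_eight_gaussianReal,
    Real.coe_toNNReal _ (h.nonneg a)]

variable [IsProbabilityMeasure P]

lemma integral_mul (h : IsGaussianFamily L B P) (a b : V) :
    ∫ ω, L a ω * L b ω ∂P = B a b := by
  have e : ∀ ω, L a ω * L b ω = 4⁻¹ * (L (a + b) ω ^ 2 - L (a - b) ω ^ 2) := by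
    intro ω
    simp only [map_add, map_sub, Pi.add_apply, Pi.sub_apply]
    ring
  simp_rw [e]
  rw [integral_const_mul, integral_sub ((h.hasAllMoments _).pow 2).integrable
    ((h.hasAllMoments _).pow 2).integrable, h.integral_sq, h.integral_sq]
  simp only [map_add, map_sub, LinearMap.add_apply, LinearMap.sub_apply, h.symm b a]
  ring

/-- Isserlis' formula for four factors, by polarising `E (L a)⁴ = 3 (B a a)²`. -/
lemma integral_mul_mul_mul (h : IsGaussianFamily L B P) (a b c d : V) :
    ∫ ω, L a ω * L b ω * (L c ω * L d ω) ∂P = B a b * B c d + B a c * B b d + B a d * B b c := by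
  have e : ∀ ω, L a ω * L b ω * (L c ω * L d ω) = 192⁻¹ *
      (((L (a + b + c + d) ω ^ 4 - L (a - b + c + d) ω ^ 4)
        - (L (a + b - c + d) ω ^ 4 - L (a - b - c + d) ω ^ 4))
      - ((L (a + b + c - d) ω ^ 4 - L (a - b + c - d) ω ^ 4)
        - (L (a + b - c - d) ω ^ 4 - L (a - b - c - d) ω ^ 4))) := by
    intro ω
    simp only [map_add, map_sub, Pi.add_apply, Pi.sub_apply]
    ring
  have i4 : ∀ u, Integrable (fun ω => L u ω ^ 4) P :=
    fun u => ((h.hasAllMoments u).pow 4).integrable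
  have i2 : ∀ u v, Integrable (fun ω => L u ω ^ 4 - L v ω ^ 4) P := fun u v => (i4 u).sub (i4 v)
  have i1 : ∀ u v w z, Integrable (fun ω => (L u ω ^ 4 - L v ω ^ 4) - (L w ω ^ 4 - L z ω ^ 4)) P :=
    fun u v w z => (i2 u v).sub (i2 w z)
  simp_rw [e]
  rw [integral_const_mul, integral_sub (i1 _ _ _ _) (i1 _ _ _ _), integral_sub (i2 _ _) (i2 _ _),
    integral_sub (i2 _ _) (i2 _ _), integral_sub (i4 _) (i4 _), integral_sub (i4 _) (i4 _),
    integral_sub (i4 _) (i4 _), integral_sub (i4 _) (i4 _)]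
  simp only [h.integral_pow_four]
  simp only [map_add, map_sub, LinearMap.add_apply, LinearMap.sub_apply,
    h.symm b a, h.symm c a, h.symm d a, h.symm c b, h.symm d b, h.symm d c]
  ring

end IsGaussianFamily

end GaussianFamily

/-! ### Linear forms of an independent Gaussian sample -/

section GaussianSample

variable {Ω : Type*} [MeasurableSpace Ω] {P : Measure Ω} {ι : Type*} [Fintype ι] [DecidableEq ι]
  {n : ℕ}

/-- A linear form of a multivariate Gaussian vector, centred at its mean. -/
lemma hasLaw_centered_linear_form {Y : Ω → EuclideanSpace ℝ ι} {m : EuclideanSpace ℝ ι}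
    {Sig : Matrix ι ι ℝ} (hS : Sig.PosDef) (hY : HasLaw Y (multivariateGaussian m Sig) P)
    (c : ι → ℝ) :
    HasLaw (fun ω => ∑ a, c a * (Y ω a - m a))
      (gaussianReal 0 (c ⬝ᵥ (Sig *ᵥ c)).toNNReal) P := by
  set Λ : StrongDual ℝ (EuclideanSpace ℝ ι) := innerSL ℝ (WithLp.toLp 2 c) with hΛ
  have hΛa : ∀ y, Λ y = ∑ a, c a * y a := fun y => by
    simp [hΛ, PiLp.inner_apply, mul_comm]
  have hmean : ∫ x, Λ x ∂(multivariateGaussian m Sig) = Λ m := by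
    rw [Λ.integral_comp_id_comm IsGaussian.integrable_id, integral_id_multivariateGaussian]
  have hvar : Var[Λ; multivariateGaussian m Sig] = c ⬝ᵥ (Sig *ᵥ c) := by
    have h1 := covarianceBilin_multivariateGaussian (μ := m) hS.posSemidef
      (WithLp.toLp 2 c) (WithLp.toLp 2 c)
    rw [covarianceBilin_apply_eq_cov IsGaussian.memLp_two_id, covariance_self (by fun_prop)] at h1
    exact h1
  have h2 : HasLaw Λ (gaussianReal (Λ m) (c ⬝ᵥ (Sig *ᵥ c)).toNNReal)
      (multivariateGaussian m Sig) :=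
    ⟨by fun_prop, by rw [IsGaussian.map_eq_gaussianReal, hmean, hvar]⟩
  have h3 : HasLaw (fun x : ℝ => x - Λ m) (gaussianReal 0 (c ⬝ᵥ (Sig *ᵥ c)).toNNReal)
      (gaussianReal (Λ m) (c ⬝ᵥ (Sig *ᵥ c)).toNNReal) :=
    ⟨by fun_prop, by rw [gaussianReal_map_sub_const, sub_self]⟩
  refine ((h3.comp h2).comp hY).congr (Eventually.of_forall fun ω => ?_)
  simp [hΛa, mul_sub, Finset.sum_sub_distrib]

/-- The linear forms of the centred sample `(Y j - m)_j`, as functions of their coefficients. -/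
noncomputable def sampleForm (m : EuclideanSpace ℝ ι) (Y : Fin n → Ω → EuclideanSpace ℝ ι) :
    (Fin n → ι → ℝ) →ₗ[ℝ] (Ω → ℝ) where
  toFun c ω := ∑ j, ∑ a, c j a * (Y j ω a - m a)
  map_add' c d := by
    funext ω
    simp [add_mul, Finset.sum_add_distrib]
  map_smul' r c := by
    funext ω
    simp [Finset.mul_sum, mul_assoc]

/-- The covariance form `∑ⱼ cⱼᵀ Σ dⱼ` of the linear forms of an independent sample of
covariance `Σ`. -/
noncomputable def sampleCov (n : ℕ) (Sig : Matrix ι ι ℝ) :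
    (Fin n → ι → ℝ) →ₗ[ℝ] (Fin n → ι → ℝ) →ₗ[ℝ] ℝ :=
  LinearMap.mk₂ ℝ (fun c d => ∑ j, c j ⬝ᵥ (Sig *ᵥ d j))
    (fun c c' d => by simp [Finset.sum_add_distrib])
    (fun r c d => by simp [Finset.mul_sum])
    (fun c d d' => by simp [mulVec_add, Finset.sum_add_distrib])
    (fun r c d => by simp [mulVec_smul, Finset.mul_sum])

theorem isGaussianFamily_sampleForm [IsProbabilityMeasure P] {m : EuclideanSpace ℝ ι}
    {Sig : Matrix ι ι ℝ} (hS : Sig.PosDef) {Y : Fin n → Ω → EuclideanSpace ℝ ι}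
    (hY : ∀ j, HasLaw (Y j) (multivariateGaussian m Sig) P) (hind : iIndepFun Y P) :
    IsGaussianFamily (sampleForm m Y) (sampleCov n Sig) P where
  symm c d := by
    have hT : Sigᵀ = Sig := by simpa using hS.isHermitian.eq
    simp only [sampleCov, LinearMap.mk₂_apply]
    refine Finset.sum_congr rfl fun j _ => ?_
    rw [dotProduct_mulVec, ← mulVec_transpose, hT, dotProduct_comm]
  nonneg c := by
    simp only [sampleCov, LinearMap.mk₂_apply]
    refine Finset.sum_nonneg fun j _ => ?_
    simpa using hS.posSemidef.dotProduct_mulVec_nonneg (c j)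
  law c := by
    have hq : ∀ j, 0 ≤ c j ⬝ᵥ (Sig *ᵥ c j) := fun j => by
      simpa using hS.posSemidef.dotProduct_mulVec_nonneg (c j)
    have hX := fun j => hasLaw_centered_linear_form hS (hY j) (c j)
    have hXind : iIndepFun (fun j ω => ∑ a, c j a * (Y j ω a - m a)) P :=
      hind.comp (fun j y => ∑ a, c j a * (y a - m a)) (fun j => by fun_prop)
    have hG : HasGaussianLaw (fun ω => ∑ j, ∑ a, c j a * (Y j ω a - m a)) P :=
      iIndepFun.hasGaussianLaw_fun_sum (fun j => (hX j).hasGaussianLaw) hXind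
    refine ⟨hG.aemeasurable, ?_⟩
    change P.map (fun ω => ∑ j, ∑ a, c j a * (Y j ω a - m a)) = _
    rw [hG.map_eq_gaussianReal]
    congr 1
    · rw [integral_finsetSum _ fun j _ => (hX j).hasGaussianLaw.integrable]
      refine Finset.sum_eq_zero fun j _ => ?_
      rw [(hX j).integral_eq]
      exact integral_id_gaussianReal
    · congr 1
      have e : (fun ω => ∑ j, ∑ a, c j a * (Y j ω a - m a))
          = ∑ j, fun ω => ∑ a, c j a * (Y j ω a - m a) := by
        funext ω; simp
      rw [e, IndepFun.variance_sum (fun j _ => (hX j).hasGaussianLaw.memLp_two)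
        fun j _ k _ hjk => hXind.indepFun hjk]
      simp only [sampleCov, LinearMap.mk₂_apply]
      refine Finset.sum_congr rfl fun j _ => ?_
      rw [(hX j).variance_eq, variance_id_gaussianReal, Real.coe_toNNReal _ (hq j)]

end GaussianSample

/-! ### Moments of the sample mean and of the scatter matrix -/

section SampleMoments

variable {Ω : Type*} {ι : Type*} {n : ℕ}

/-- The coordinates of the sample mean. -/
noncomputable def smean (y : Fin n → EuclideanSpace ℝ ι) (a : ι) : ℝ :=
  (n : ℝ)⁻¹ * ∑ j, y j a

/-- The entries of the scatter matrix of a sample of vectors. -/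
noncomputable def scat (y : Fin n → EuclideanSpace ℝ ι) (a b : ι) : ℝ :=
  ∑ j, (y j a - smean y a) * (y j b - smean y b)

lemma scat_comm (y : Fin n → EuclideanSpace ℝ ι) (a b : ι) : scat y a b = scat y b a :=
  Finset.sum_congr rfl fun _ _ => mul_comm _ _

lemma scat_self_nonneg (y : Fin n → EuclideanSpace ℝ ι) (a : ι) : 0 ≤ scat y a a :=
  Finset.sum_nonneg fun _ _ => mul_self_nonneg _

lemma measurable_smean (a : ι) :
    Measurable fun y : Fin n → EuclideanSpace ℝ ι => smean y a := by
  unfold smean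
  fun_prop

lemma measurable_scat (a b : ι) :
    Measurable fun y : Fin n → EuclideanSpace ℝ ι => scat y a b := by
  have := measurable_smean (n := n) a
  have := measurable_smean (n := n) b
  unfold scat
  fun_prop

section Coefficients

variable [DecidableEq ι]

/-- Coefficients of the linear form `Y j a - smean Y a`. -/
noncomputable def devCoeff (j : Fin n) (a : ι) : Fin n → ι → ℝ :=
  fun k b => ((if j = k then 1 else 0) - (n : ℝ)⁻¹) * (if a = b then 1 else 0)

/-- Coefficients of the linear form `smean Y a - m a`. -/
noncomputable def meanCoeff (n : ℕ) (a : ι) : Fin n → ι → ℝ :=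
  fun _ b => (n : ℝ)⁻¹ * (if a = b then 1 else 0)

variable [Fintype ι]

lemma sampleForm_meanCoeff (hn : n ≠ 0) (m : EuclideanSpace ℝ ι)
    (Y : Fin n → Ω → EuclideanSpace ℝ ι) (a : ι) (ω : Ω) :
    sampleForm m Y (meanCoeff n a) ω = smean (fun j => Y j ω) a - m a := by
  have hn' : (n : ℝ) ≠ 0 := by exact_mod_cast hn
  simp only [sampleForm, LinearMap.coe_mk, AddHom.coe_mk, meanCoeff, smean]
  simp only [mul_assoc, ite_mul, one_mul, zero_mul, mul_ite, mul_zero, Finset.sum_ite_eq,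
    Finset.mem_univ, if_true]
  rw [← Finset.mul_sum, Finset.sum_sub_distrib]
  simp
  field_simp

lemma sampleForm_devCoeff (hn : n ≠ 0) (m : EuclideanSpace ℝ ι)
    (Y : Fin n → Ω → EuclideanSpace ℝ ι) (j : Fin n) (a : ι) (ω : Ω) :
    sampleForm m Y (devCoeff j a) ω = Y j ω a - smean (fun j => Y j ω) a := by
  have hn' : (n : ℝ) ≠ 0 := by exact_mod_cast hn
  simp only [sampleForm, LinearMap.coe_mk, AddHom.coe_mk, devCoeff, smean]
  simp only [mul_assoc, ite_mul, one_mul, zero_mul, mul_ite, mul_zero, Finset.sum_ite_eq,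
    Finset.mem_univ, if_true, sub_mul, Finset.sum_sub_distrib]
  rw [← Finset.mul_sum, Finset.sum_sub_distrib]
  simp
  field_simp
  ring

lemma sampleCov_product (Sig : Matrix ι ι ℝ) (u v : Fin n → ℝ) (a b : ι) :
    sampleCov n Sig (fun k c => u k * (if a = c then 1 else 0))
      (fun k c => v k * (if b = c then 1 else 0)) = (∑ k, u k * v k) * Sig a b := by
  simp only [sampleCov, LinearMap.mk₂_apply, dotProduct, mulVec, Finset.sum_mul]
  refine Finset.sum_congr rfl fun k _ => ?_
  simp [mul_ite]
  ring

lemma sampleCov_meanCoeff (hn : n ≠ 0) (Sig : Matrix ι ι ℝ) (a b : ι) :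
    sampleCov n Sig (meanCoeff n a) (meanCoeff n b) = (n : ℝ)⁻¹ * Sig a b := by
  have hn' : (n : ℝ) ≠ 0 := by exact_mod_cast hn
  refine (sampleCov_product Sig (fun _ => (n : ℝ)⁻¹) (fun _ => (n : ℝ)⁻¹) a b).trans ?_
  congr 1
  simp
  field_simp

lemma sampleCov_devCoeff (hn : n ≠ 0) (Sig : Matrix ι ι ℝ) (j k : Fin n) (a b : ι) :
    sampleCov n Sig (devCoeff j a) (devCoeff k b)
      = ((if j = k then 1 else 0) - (n : ℝ)⁻¹) * Sig a b := by
  have hn' : (n : ℝ) ≠ 0 := by exact_mod_cast hn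
  refine (sampleCov_product Sig (fun l => (if j = l then 1 else 0) - (n : ℝ)⁻¹)
    (fun l => (if k = l then 1 else 0) - (n : ℝ)⁻¹) a b).trans ?_
  congr 1
  simp only [sub_mul, mul_sub, ite_mul, one_mul, zero_mul, mul_ite, mul_one, mul_zero,
    Finset.sum_sub_distrib, Finset.sum_ite_eq, Finset.mem_univ, if_true]
  simp [eq_comm]
  field_simp
  ring

/-- The trace of the centring matrix `1 - J / n`, with `J` the all-ones matrix. -/
lemma sum_centering_diag (hn : n ≠ 0) :
    ∑ _j : Fin n, (1 - (n : ℝ)⁻¹) = n - 1 := by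
  have hn' : (n : ℝ) ≠ 0 := by exact_mod_cast hn
  simp
  field_simp

/-- The squared Frobenius norm of the centring matrix; it equals the trace, as for every
orthogonal projection. -/
lemma sum_centering_sq (hn : n ≠ 0) :
    ∑ j : Fin n, ∑ k : Fin n, ((if j = k then (1 : ℝ) else 0) - (n : ℝ)⁻¹) ^ 2 = n - 1 := by
  have hn' : (n : ℝ) ≠ 0 := by exact_mod_cast hn
  have e : ∀ j k : Fin n, ((if j = k then (1 : ℝ) else 0) - (n : ℝ)⁻¹) ^ 2
      = (if j = k then 1 - 2 * (n : ℝ)⁻¹ else 0) + (n : ℝ)⁻¹ ^ 2 := by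
    intro j k
    split_ifs <;> ring
  simp only [e, Finset.sum_add_distrib, Finset.sum_ite_eq, Finset.mem_univ, if_true]
  simp
  field_simp
  ring

end Coefficients

variable [MeasurableSpace Ω] {P : Measure Ω} [Fintype ι] [DecidableEq ι]

/-- `Y` is an independent sample from the Gaussian law with mean `m` and covariance `Sig`. -/
structure IsGaussianSample (Y : Fin n → Ω → EuclideanSpace ℝ ι) (m : EuclideanSpace ℝ ι)
    (Sig : Matrix ι ι ℝ) (P : Measure Ω) : Prop where
  posDef : Sig.PosDef
  law : ∀ j, HasLaw (Y j) (multivariateGaussian m Sig) P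
  indep : iIndepFun Y P

namespace IsGaussianSample

variable [IsProbabilityMeasure P] {Y : Fin n → Ω → EuclideanSpace ℝ ι} {m : EuclideanSpace ℝ ι}
  {Sig : Matrix ι ι ℝ}

lemma family (h : IsGaussianSample Y m Sig P) :
    IsGaussianFamily (sampleForm m Y) (sampleCov n Sig) P :=
  isGaussianFamily_sampleForm h.posDef h.law h.indep

lemma dev_allMoments (h : IsGaussianSample Y m Sig P) (hn : n ≠ 0) (j : Fin n) (a : ι) :
    HasAllMoments (fun ω => Y j ω a - smean (fun j => Y j ω) a) P := by
  have := h.family.hasAllMoments (devCoeff j a)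
  rwa [funext fun ω => sampleForm_devCoeff hn m Y j a ω] at this

lemma mean_allMoments (h : IsGaussianSample Y m Sig P) (hn : n ≠ 0) (a : ι) :
    HasAllMoments (fun ω => smean (fun j => Y j ω) a - m a) P := by
  have := h.family.hasAllMoments (meanCoeff n a)
  rwa [funext fun ω => sampleForm_meanCoeff hn m Y a ω] at this

lemma scat_allMoments (h : IsGaussianSample Y m Sig P) (hn : n ≠ 0) (a b : ι) :
    HasAllMoments (fun ω => scat (fun j => Y j ω) a b) P :=
  .sum _ fun j _ => (h.dev_allMoments hn j a).mul (h.dev_allMoments hn j b)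

lemma integral_mean (h : IsGaussianSample Y m Sig P) (hn : n ≠ 0) (a : ι) :
    ∫ ω, (smean (fun j => Y j ω) a - m a) ∂P = 0 := by
  simpa only [sampleForm_meanCoeff hn] using h.family.integral_eq_zero (meanCoeff n a)

lemma integral_mean_mul (h : IsGaussianSample Y m Sig P) (hn : n ≠ 0) (a b : ι) :
    ∫ ω, (smean (fun j => Y j ω) a - m a) * (smean (fun j => Y j ω) b - m b) ∂P
      = (n : ℝ)⁻¹ * Sig a b := by
  simpa only [sampleForm_meanCoeff hn, sampleCov_meanCoeff hn] using
    h.family.integral_mul (meanCoeff n a) (meanCoeff n b)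

lemma integral_scat (h : IsGaussianSample Y m Sig P) (hn : n ≠ 0) (a b : ι) :
    ∫ ω, scat (fun j => Y j ω) a b ∂P = ((n : ℝ) - 1) * Sig a b := by
  unfold scat
  rw [integral_finsetSum _ fun j _ =>
    ((h.dev_allMoments hn j a).mul (h.dev_allMoments hn j b)).integrable]
  rw [← sum_centering_diag hn, Finset.sum_mul]
  refine Finset.sum_congr rfl fun j _ => ?_
  simpa only [sampleForm_devCoeff hn, sampleCov_devCoeff hn, if_true] using
    h.family.integral_mul (devCoeff j a) (devCoeff j b)

/-- The second moments of a Wishart matrix with `n - 1` degrees of freedom. -/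
lemma integral_scat_mul (h : IsGaussianSample Y m Sig P) (hn : n ≠ 0) (a b c d : ι) :
    ∫ ω, scat (fun j => Y j ω) a b * scat (fun j => Y j ω) c d ∂P
      = ((n : ℝ) - 1) ^ 2 * (Sig a b * Sig c d)
        + ((n : ℝ) - 1) * (Sig a c * Sig b d + Sig a d * Sig b c) := by
  unfold scat
  simp only [Finset.sum_mul_sum]
  have hI : ∀ j k : Fin n, HasAllMoments (fun ω =>
      ((Y j ω a - smean (fun j => Y j ω) a) * (Y j ω b - smean (fun j => Y j ω) b))
      * ((Y k ω c - smean (fun j => Y j ω) c) * (Y k ω d - smean (fun j => Y j ω) d))) P :=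
    fun j k => ((h.dev_allMoments hn j a).mul (h.dev_allMoments hn j b)).mul
      ((h.dev_allMoments hn k c).mul (h.dev_allMoments hn k d))
  rw [integral_finsetSum _ fun j _ => (HasAllMoments.sum _ fun k _ => hI j k).integrable]
  simp_rw [integral_finsetSum _ fun k _ => (hI _ k).integrable]
  have e : ∀ j k : Fin n, ∫ ω,
      ((Y j ω a - smean (fun j => Y j ω) a) * (Y j ω b - smean (fun j => Y j ω) b))
      * ((Y k ω c - smean (fun j => Y j ω) c) * (Y k ω d - smean (fun j => Y j ω) d)) ∂P
      = (1 - (n : ℝ)⁻¹) * (1 - (n : ℝ)⁻¹)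
          * (Sig a b * Sig c d)
        + ((if j = k then 1 else 0) - (n : ℝ)⁻¹) ^ 2
          * (Sig a c * Sig b d + Sig a d * Sig b c) := by
    intro j k
    have := h.family.integral_mul_mul_mul (devCoeff j a) (devCoeff j b) (devCoeff k c)
      (devCoeff k d)
    simp only [sampleForm_devCoeff hn, sampleCov_devCoeff hn, if_true] at this
    rw [this]
    ring
  simp_rw [e, Finset.sum_add_distrib, ← Finset.sum_mul]
  rw [sum_centering_sq hn, ← sum_centering_diag hn]
  simp only [Finset.sum_const, Finset.card_univ, Fintype.card_fin, nsmul_eq_mul]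
  ring

end IsGaussianSample

/-- The total squared deviation `∑ⱼ ‖y j - m‖²` from the true mean; it dominates all the
statistics below. -/
noncomputable def energy (m : EuclideanSpace ℝ ι) (y : Fin n → EuclideanSpace ℝ ι) : ℝ :=
  ∑ j, ∑ a, (y j a - m a) ^ 2

omit [DecidableEq ι] in
lemma energy_nonneg (m : EuclideanSpace ℝ ι) (y : Fin n → EuclideanSpace ℝ ι) :
    0 ≤ energy m y :=
  Finset.sum_nonneg fun _ _ => Finset.sum_nonneg fun _ _ => sq_nonneg _

omit [DecidableEq ι] in
/-- Steiner's identity: deviations from `m` split into deviations from the sample mean and the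
deviation of the sample mean from `m`. -/
lemma energy_eq_scat (hn : n ≠ 0) (m : EuclideanSpace ℝ ι) (y : Fin n → EuclideanSpace ℝ ι) :
    energy m y = ∑ a, scat y a a + n * ∑ a, (smean y a - m a) ^ 2 := by
  have hn' : (n : ℝ) ≠ 0 := by exact_mod_cast hn
  rw [energy, Finset.sum_comm, Finset.mul_sum, ← Finset.sum_add_distrib]
  refine Finset.sum_congr rfl fun a _ => ?_
  have h1 : ∑ j, (y j a - smean y a) = 0 := by
    rw [Finset.sum_sub_distrib, smean]
    simp
    field_simp
    simp
  have e : ∀ j, (y j a - m a) ^ 2 = (y j a - smean y a) * (y j a - smean y a)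
      + 2 * (smean y a - m a) * (y j a - smean y a) + (smean y a - m a) ^ 2 := fun j => by ring
  simp only [e, Finset.sum_add_distrib, ← Finset.mul_sum, h1]
  simp [scat]

omit [DecidableEq ι] in
lemma sum_mean_sq_le_energy (hn : n ≠ 0) (m : EuclideanSpace ℝ ι)
    (y : Fin n → EuclideanSpace ℝ ι) : ∑ a, (smean y a - m a) ^ 2 ≤ energy m y := by
  rw [energy_eq_scat hn]
  have h1 : 0 ≤ ∑ a, scat y a a := Finset.sum_nonneg fun a _ => scat_self_nonneg y a
  have h2 : 0 ≤ ∑ a, (smean y a - m a) ^ 2 := Finset.sum_nonneg fun a _ => sq_nonneg _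
  have h3 : (1 : ℝ) ≤ n := by exact_mod_cast Nat.one_le_iff_ne_zero.2 hn
  nlinarith

omit [DecidableEq ι] in
lemma trace_scat_le_energy (hn : n ≠ 0) (m : EuclideanSpace ℝ ι)
    (y : Fin n → EuclideanSpace ℝ ι) : ∑ a, scat y a a ≤ energy m y := by
  rw [energy_eq_scat hn]
  have h2 : 0 ≤ ∑ a, (smean y a - m a) ^ 2 := Finset.sum_nonneg fun a _ => sq_nonneg _
  have : 0 ≤ (n : ℝ) * ∑ a, (smean y a - m a) ^ 2 := by positivity
  linarith

omit [DecidableEq ι] in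
lemma sum_scat_sq_le_energy (hn : n ≠ 0) (m : EuclideanSpace ℝ ι)
    (y : Fin n → EuclideanSpace ℝ ι) : ∑ a, ∑ b, scat y a b ^ 2 ≤ energy m y ^ 2 := by
  have h0 : 0 ≤ ∑ a, scat y a a := Finset.sum_nonneg fun a _ => scat_self_nonneg y a
  calc ∑ a, ∑ b, scat y a b ^ 2 ≤ ∑ a, ∑ b, scat y a a * scat y b b := by
        refine Finset.sum_le_sum fun a _ => Finset.sum_le_sum fun b _ => ?_
        have := Finset.sum_mul_sq_le_sq_mul_sq Finset.univ (fun j => y j a - smean y a)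
          (fun j => y j b - smean y b)
        simpa [scat, pow_two] using this
    _ = (∑ a, scat y a a) ^ 2 := by rw [pow_two, Finset.sum_mul_sum]
    _ ≤ _ := pow_le_pow_left₀ h0 (trace_scat_le_energy hn m y) 2

/-- The fourth moment of the energy is controlled by the trace of the covariance: it is a sum of
eighth moments of Gaussian variables. -/
lemma exists_integral_energy_pow_four_le (n : ℕ) (ι : Type*) [Fintype ι] [DecidableEq ι] :
    ∃ C : ℝ, 0 ≤ C ∧ ∀ {Ω : Type*} [MeasurableSpace Ω] (P : Measure Ω) [IsProbabilityMeasure P]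
      (Y : Fin n → Ω → EuclideanSpace ℝ ι) (m : EuclideanSpace ℝ ι) (Sig : Matrix ι ι ℝ),
      IsGaussianSample Y m Sig P →
      HasAllMoments (fun ω => energy m (fun j => Y j ω)) P ∧
      ∫ ω, energy m (fun j => Y j ω) ^ 4 ∂P ≤ C * Sig.trace ^ 4 := by
  set c8 : ℝ := ∫ x, x ^ 8 ∂(gaussianReal 0 1) with hc8
  have hc8n : 0 ≤ c8 := integral_nonneg fun x => by positivity
  refine ⟨(Fintype.card (Fin n × ι) : ℝ) ^ 3 * (Fintype.card (Fin n × ι) * c8), by positivity, ?_⟩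
  intro Ω _ P _ Y m Sig h
  have hf : ∀ j a ω, sampleForm m Y (fun k b => (if j = k then 1 else 0) * (if a = b then 1 else 0))
      ω = Y j ω a - m a := by
    intro j a ω
    simp [sampleForm]
  have hc : ∀ (j : Fin n) (a : ι),
      sampleCov n Sig (fun k b => (if j = k then 1 else 0) * (if a = b then 1 else 0))
      (fun k b => (if j = k then 1 else 0) * (if a = b then 1 else 0)) = Sig a a := by
    intro j a
    rw [sampleCov_product]
    simp
  have hM : ∀ j a, HasAllMoments (fun ω => Y j ω a - m a) P := by
    intro j a
    have := h.family.hasAllMoments (fun k b => (if j = k then 1 else 0) * (if a = b then 1 else 0))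
    rwa [funext (hf j a)] at this
  have h8 : ∀ j a, ∫ ω, (Y j ω a - m a) ^ 8 ∂P = c8 * Sig a a ^ 4 := by
    intro j a
    have := h.family.integral_pow_eight
      (fun k b => (if j = k then 1 else 0) * (if a = b then 1 else 0))
    rw [hc] at this
    simpa only [hf] using this
  refine ⟨.sum _ fun j _ => .sum _ fun a _ => (hM j a).pow 2, ?_⟩
  have hdiag : ∀ a, 0 ≤ Sig a a := fun a => h.posDef.posSemidef.diag_nonneg
  have hp : ∀ ω, energy m (fun j => Y j ω) ^ 4
      ≤ (Fintype.card (Fin n × ι) : ℝ) ^ 3 * ∑ x : Fin n × ι, (Y x.1 ω x.2 - m x.2) ^ 8 := by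
    intro ω
    have e : energy m (fun j => Y j ω) = ∑ x : Fin n × ι, (Y x.1 ω x.2 - m x.2) ^ 2 := by
      rw [energy, Fintype.sum_prod_type]
    rw [e]
    have h1 := pow_sum_le_card_mul_sum_pow (s := Finset.univ)
      (f := fun x : Fin n × ι => (Y x.1 ω x.2 - m x.2) ^ 2) (fun x _ => sq_nonneg _) 3
    simpa [← pow_mul, Finset.card_univ] using h1
  have hI8 : ∀ x : Fin n × ι, Integrable (fun ω => (Y x.1 ω x.2 - m x.2) ^ 8) P :=
    fun x => ((hM x.1 x.2).pow 8).integrable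
  calc ∫ ω, energy m (fun j => Y j ω) ^ 4 ∂P
      ≤ ∫ ω, (Fintype.card (Fin n × ι) : ℝ) ^ 3 *
          ∑ x : Fin n × ι, (Y x.1 ω x.2 - m x.2) ^ 8 ∂P := by
        refine integral_mono ?_ ?_ hp
        · exact ((HasAllMoments.sum _ fun j _ =>
            .sum _ fun a _ => (hM j a).pow 2).pow 4).integrable
        · exact (integrable_finsetSum _ fun x _ => hI8 x).const_mul _
    _ = (Fintype.card (Fin n × ι) : ℝ) ^ 3 * ∑ x : Fin n × ι, c8 * Sig x.2 x.2 ^ 4 := by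
        rw [integral_const_mul, integral_finsetSum _ fun x _ => hI8 x]
        simp only [h8]
    _ ≤ (Fintype.card (Fin n × ι) : ℝ) ^ 3 * ∑ x : Fin n × ι, c8 * Sig.trace ^ 4 := by
        gcongr with x
        · exact hdiag _
        · exact Finset.single_le_sum (f := fun a => Sig a a) (fun a _ => hdiag a)
            (Finset.mem_univ x.2)
    _ = _ := by
        simp
        ring

end SampleMoments

/-! ### The centred statistics that make up the gap between risk estimate and loss -/

section GapStatistics

variable {ι : Type*} [Fintype ι] {n : ℕ}

/-- Unbiased estimate of `‖smean - m‖²` minus its value. -/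
noncomputable def normGap (m : EuclideanSpace ℝ ι) (y : Fin n → EuclideanSpace ℝ ι) : ℝ :=
  (∑ a, scat y a a) / (n * ((n : ℝ) - 1)) - ∑ a, (smean y a - m a) ^ 2

/-- The inner product of the sampling error `smean - m` with `m`. -/
noncomputable def crossGap (m : EuclideanSpace ℝ ι) (y : Fin n → EuclideanSpace ℝ ι) : ℝ :=
  ∑ a, (smean y a - m a) * m a

/-- The entries of the scatter matrix minus their expectations. -/
noncomputable def scatGap (Sig : Matrix ι ι ℝ) (y : Fin n → EuclideanSpace ℝ ι) (a b : ι) : ℝ :=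
  scat y a b - ((n : ℝ) - 1) * Sig a b

/-- Unbiased estimate of `‖S - (n - 1) Σ‖²` minus its value. -/
noncomputable def covGapZero (Sig : Matrix ι ι ℝ) (y : Fin n → EuclideanSpace ℝ ι) : ℝ :=
  ((n : ℝ) - 3) / (((n : ℝ) + 1) * ((n : ℝ) - 2)) * ∑ a, ∑ b, scat y a b ^ 2
    + ((n : ℝ) - 1) / (((n : ℝ) + 1) * ((n : ℝ) - 2)) * (∑ a, scat y a a) ^ 2
    - ∑ a, ∑ b, scatGap Sig y a b ^ 2

/-- The inner product of `Σ` with the centred scatter matrix. -/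
noncomputable def covGapOne (Sig : Matrix ι ι ℝ) (y : Fin n → EuclideanSpace ℝ ι) : ℝ :=
  ∑ a, ∑ b, Sig a b * scatGap Sig y a b

/-- Unbiased estimate of `‖Σ‖²` minus its value. -/
noncomputable def covGapTwo (Sig : Matrix ι ι ℝ) (y : Fin n → EuclideanSpace ℝ ι) : ℝ :=
  1 / (((n : ℝ) + 1) * ((n : ℝ) - 2)) * ∑ a, ∑ b, scat y a b ^ 2
    - 1 / (((n : ℝ) - 1) * ((n : ℝ) + 1) * ((n : ℝ) - 2)) * (∑ a, scat y a a) ^ 2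
    - ∑ a, ∑ b, Sig a b ^ 2

/-- Index set of the statistics: five scalars, the coordinates of the sampling error and the
entries of the centred scatter matrix. -/
abbrev GapIdx (ι : Type*) : Type _ := Fin 5 ⊕ ι ⊕ ι × ι

/-- The centred statistics, as one finite family. -/
noncomputable def gapStat (m : EuclideanSpace ℝ ι) (Sig : Matrix ι ι ℝ) :
    GapIdx ι → (Fin n → EuclideanSpace ℝ ι) → ℝ :=
  Sum.elim ![normGap m, crossGap m, covGapZero Sig, covGapOne Sig, covGapTwo Sig]
    (Sum.elim (fun a y => smean y a - m a) (fun ab y => scatGap Sig y ab.1 ab.2))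

/-- To prove something of every statistic, treat the seven kinds. -/
lemma forall_gapStat {m : EuclideanSpace ℝ ι} {Sig : Matrix ι ι ℝ}
    {p : ((Fin n → EuclideanSpace ℝ ι) → ℝ) → Prop} (h0 : p (normGap m)) (h1 : p (crossGap m))
    (h2 : p (covGapZero Sig)) (h3 : p (covGapOne Sig)) (h4 : p (covGapTwo Sig))
    (h5 : ∀ a, p fun y => smean y a - m a) (h6 : ∀ a b, p fun y => scatGap Sig y a b)
    (k : GapIdx ι) : p (gapStat m Sig k) := by
  rcases k with k | a | ab
  · fin_cases k
    exacts [h0, h1, h2, h3, h4]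
  · exact h5 a
  · exact h6 ab.1 ab.2

lemma measurable_gapStat (m : EuclideanSpace ℝ ι) (Sig : Matrix ι ι ℝ) (k : GapIdx ι) :
    Measurable (gapStat (n := n) m Sig k) := by
  have h1 := measurable_smean (n := n) (ι := ι)
  have h2 := measurable_scat (n := n) (ι := ι)
  have h3 : ∀ a b, Measurable fun y : Fin n → EuclideanSpace ℝ ι => scatGap Sig y a b :=
    fun a b => (h2 a b).sub_const _
  refine forall_gapStat ?_ ?_ ?_ ?_ ?_ ?_ ?_ k
  · unfold normGap; fun_prop
  · unfold crossGap; fun_prop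
  · unfold covGapZero; fun_prop
  · unfold covGapOne; fun_prop
  · unfold covGapTwo; fun_prop
  · intro a; fun_prop
  · intro a b; fun_prop

variable {Ω : Type*} [MeasurableSpace Ω] {P : Measure Ω} [DecidableEq ι]

namespace IsGaussianSample

variable [IsProbabilityMeasure P] {Y : Fin n → Ω → EuclideanSpace ℝ ι} {m : EuclideanSpace ℝ ι}
  {Sig : Matrix ι ι ℝ}

lemma scatGap_allMoments (h : IsGaussianSample Y m Sig P) (hn : n ≠ 0) (a b : ι) :
    HasAllMoments (fun ω => scatGap Sig (fun j => Y j ω) a b) P :=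
  (h.scat_allMoments hn a b).sub (.const _)

lemma gapStat_allMoments (h : IsGaussianSample Y m Sig P) (hn : n ≠ 0) (k : GapIdx ι) :
    HasAllMoments (fun ω => gapStat m Sig k (fun j => Y j ω)) P := by
  have hs2 : HasAllMoments (fun ω => ∑ a, ∑ b, scat (fun j => Y j ω) a b ^ 2) P :=
    .sum _ fun a _ => .sum _ fun b _ => (h.scat_allMoments hn a b).pow 2
  have htr : HasAllMoments (fun ω => ∑ a, scat (fun j => Y j ω) a a) P :=
    .sum _ fun a _ => h.scat_allMoments hn a a
  refine forall_gapStat (p := fun f => HasAllMoments (fun ω => f (fun j => Y j ω)) P)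
    ?_ ?_ ?_ ?_ ?_ ?_ ?_ k
  · exact (htr.div_const _).sub (.sum _ fun a _ => (h.mean_allMoments hn a).pow 2)
  · exact .sum _ fun a _ => (h.mean_allMoments hn a).mul (.const _)
  · exact ((hs2.const_mul _).add ((htr.pow 2).const_mul _)).sub
      (.sum _ fun a _ => .sum _ fun b _ => (h.scatGap_allMoments hn a b).pow 2)
  · exact .sum _ fun a _ => .sum _ fun b _ => (h.scatGap_allMoments hn a b).const_mul _
  · exact ((hs2.const_mul _).sub ((htr.pow 2).const_mul _)).sub (.const _)
  · exact fun a => h.mean_allMoments hn a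
  · exact fun a b => h.scatGap_allMoments hn a b

lemma integral_scatGap (h : IsGaussianSample Y m Sig P) (hn : n ≠ 0) (a b : ι) :
    ∫ ω, scatGap Sig (fun j => Y j ω) a b ∂P = 0 := by
  unfold scatGap
  rw [integral_sub (h.scat_allMoments hn a b).integrable (integrable_const _),
    h.integral_scat hn]
  simp

lemma integral_scatGap_sq (h : IsGaussianSample Y m Sig P) (hn : n ≠ 0) (a b : ι) :
    ∫ ω, scatGap Sig (fun j => Y j ω) a b ^ 2 ∂P
      = ((n : ℝ) - 1) * (Sig a a * Sig b b + Sig a b ^ 2) := by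
  have hsymm : Sig b a = Sig a b := by simpa using h.posDef.isHermitian.apply a b
  have e : ∀ ω, scatGap Sig (fun j => Y j ω) a b ^ 2
      = scat (fun j => Y j ω) a b * scat (fun j => Y j ω) a b
        - 2 * (((n : ℝ) - 1) * Sig a b) * scatGap Sig (fun j => Y j ω) a b
        - (((n : ℝ) - 1) * Sig a b) ^ 2 := by
    intro ω
    unfold scatGap
    ring
  have i1 := (h.scat_allMoments hn a b).mul (h.scat_allMoments hn a b)
  have i2 := (h.scatGap_allMoments hn a b).const_mul (2 * (((n : ℝ) - 1) * Sig a b))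
  simp_rw [e]
  rw [integral_sub (i1.sub i2).integrable (integrable_const _),
    integral_sub i1.integrable i2.integrable, integral_const_mul, h.integral_scatGap hn,
    h.integral_scat_mul hn]
  simp [hsymm]
  ring

/-- The expectation of `tr S²`. -/
lemma integral_sum_scat_sq (h : IsGaussianSample Y m Sig P) (hn : n ≠ 0) :
    ∫ ω, ∑ a, ∑ b, scat (fun j => Y j ω) a b ^ 2 ∂P
      = ((n : ℝ) - 1) * (n * ∑ a, ∑ b, Sig a b ^ 2 + Sig.trace ^ 2) := by
  have hsymm : ∀ a b, Sig b a = Sig a b := fun a b => by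
    simpa using h.posDef.isHermitian.apply a b
  rw [integral_finsetSum _ fun a _ =>
    (HasAllMoments.sum _ fun b _ => (h.scat_allMoments hn a b).pow 2).integrable]
  simp_rw [integral_finsetSum _ fun b _ => ((h.scat_allMoments hn _ b).pow 2).integrable,
    pow_two (scat _ _ _), h.integral_scat_mul hn]
  simp only [trace, diag_apply, pow_two (∑ a, Sig a a), Finset.sum_mul_sum]
  simp only [Finset.mul_sum, ← Finset.sum_add_distrib]
  refine Finset.sum_congr rfl fun a _ => Finset.sum_congr rfl fun b _ => ?_
  rw [hsymm a b]
  ring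

/-- The expectation of `(tr S)²`. -/
lemma integral_trace_sq (h : IsGaussianSample Y m Sig P) (hn : n ≠ 0) :
    ∫ ω, (∑ a, scat (fun j => Y j ω) a a) ^ 2 ∂P
      = ((n : ℝ) - 1) * (2 * ∑ a, ∑ b, Sig a b ^ 2 + ((n : ℝ) - 1) * Sig.trace ^ 2) := by
  simp only [pow_two (∑ a, scat _ a a), Finset.sum_mul_sum]
  rw [integral_finsetSum _ fun a _ => (HasAllMoments.sum _ fun b _ =>
    (h.scat_allMoments hn a a).mul (h.scat_allMoments hn b b)).integrable]
  simp_rw [integral_finsetSum _ fun b _ =>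
    ((h.scat_allMoments hn _ _).mul (h.scat_allMoments hn b b)).integrable,
    h.integral_scat_mul hn]
  simp only [trace, diag_apply, pow_two (∑ a, Sig a a), Finset.sum_mul_sum]
  simp only [Finset.mul_sum, ← Finset.sum_add_distrib]
  refine Finset.sum_congr rfl fun a _ => Finset.sum_congr rfl fun b _ => ?_
  ring

/-- Every statistic is centred. -/
lemma integral_gapStat (h : IsGaussianSample Y m Sig P) (hn : 3 ≤ n) (k : GapIdx ι) :
    ∫ ω, gapStat m Sig k (fun j => Y j ω) ∂P = 0 := by
  have hn0 : n ≠ 0 := by omega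
  have hnR : (3 : ℝ) ≤ n := by exact_mod_cast hn
  have d0 : (n : ℝ) ≠ 0 := by linarith
  have d1 : (n : ℝ) - 1 ≠ 0 := by linarith
  have d2 : (n : ℝ) - 2 ≠ 0 := by linarith
  have d3 : (n : ℝ) + 1 ≠ 0 := by linarith
  have hs2 : HasAllMoments (fun ω => ∑ a, ∑ b, scat (fun j => Y j ω) a b ^ 2) P :=
    .sum _ fun a _ => .sum _ fun b _ => (h.scat_allMoments hn0 a b).pow 2
  have htr : HasAllMoments (fun ω => ∑ a, scat (fun j => Y j ω) a a) P :=
    .sum _ fun a _ => h.scat_allMoments hn0 a a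
  refine forall_gapStat (p := fun f => ∫ ω, f (fun j => Y j ω) ∂P = 0) ?_ ?_ ?_ ?_ ?_ ?_ ?_ k
  · unfold normGap
    have hw : ∀ a, Integrable (fun ω => (smean (fun j => Y j ω) a - m a) ^ 2) P :=
      fun a => ((h.mean_allMoments hn0 a).pow 2).integrable
    rw [integral_sub (htr.div_const _).integrable (integrable_finsetSum _ fun a _ => hw a),
      integral_div, integral_finsetSum _ fun a _ => (h.scat_allMoments hn0 a a).integrable,
      integral_finsetSum _ fun a _ => hw a]
    simp_rw [pow_two, h.integral_mean_mul hn0, h.integral_scat hn0, ← Finset.mul_sum]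
    field_simp
    ring
  · unfold crossGap
    rw [integral_finsetSum _ fun a _ => ((h.mean_allMoments hn0 a).mul (.const _)).integrable]
    simp_rw [integral_mul_const, h.integral_mean hn0]
    simp
  · have hT2 : HasAllMoments (fun ω => ∑ a, ∑ b, scatGap Sig (fun j => Y j ω) a b ^ 2) P :=
      .sum _ fun a _ => .sum _ fun b _ => (h.scatGap_allMoments hn0 a b).pow 2
    have hT2i : ∫ ω, ∑ a, ∑ b, scatGap Sig (fun j => Y j ω) a b ^ 2 ∂P
        = ((n : ℝ) - 1) * (∑ a, ∑ b, Sig a b ^ 2 + Sig.trace ^ 2) := by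
      rw [integral_finsetSum _ fun a _ =>
        (HasAllMoments.sum _ fun b _ => (h.scatGap_allMoments hn0 a b).pow 2).integrable]
      simp_rw [integral_finsetSum _ fun b _ => ((h.scatGap_allMoments hn0 _ b).pow 2).integrable,
        h.integral_scatGap_sq hn0]
      simp only [trace, diag_apply, pow_two (∑ a, Sig a a), Finset.sum_mul_sum]
      simp only [Finset.mul_sum, ← Finset.sum_add_distrib]
      refine Finset.sum_congr rfl fun a _ => Finset.sum_congr rfl fun b _ => ?_
      ring
    unfold covGapZero
    rw [integral_sub ((hs2.const_mul _).add ((htr.pow 2).const_mul _)).integrable hT2.integrable,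
      integral_add (hs2.const_mul _).integrable ((htr.pow 2).const_mul _).integrable,
      integral_const_mul, integral_const_mul, h.integral_sum_scat_sq hn0,
      h.integral_trace_sq hn0, hT2i]
    field_simp
    ring
  · unfold covGapOne
    rw [integral_finsetSum _ fun a _ => (HasAllMoments.sum _ fun b _ =>
      (h.scatGap_allMoments hn0 a b).const_mul (Sig a b)).integrable]
    simp_rw [integral_finsetSum _ fun b _ =>
      ((h.scatGap_allMoments hn0 _ b).const_mul (Sig _ b)).integrable, integral_const_mul,
      h.integral_scatGap hn0]
    simp
  · unfold covGapTwo
    rw [integral_sub ((hs2.const_mul _).sub ((htr.pow 2).const_mul _)).integrable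
        (integrable_const _),
      integral_sub (hs2.const_mul _).integrable ((htr.pow 2).const_mul _).integrable,
      integral_const_mul, integral_const_mul, h.integral_sum_scat_sq hn0,
      h.integral_trace_sq hn0]
    simp only [integral_const, probReal_univ, smul_eq_mul, one_mul]
    field_simp
    ring
  · exact fun a => h.integral_mean hn0 a
  · exact fun a b => h.integral_scatGap hn0 a b

/-- The variance of `⟨smean - m, m⟩` is `mᵀ Σ m / n`. -/
lemma integral_crossGap_sq (h : IsGaussianSample Y m Sig P) (hn : n ≠ 0) :
    ∫ ω, crossGap m (fun j => Y j ω) ^ 2 ∂P = (n : ℝ)⁻¹ * (m.ofLp ⬝ᵥ (Sig *ᵥ m.ofLp)) := by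
  have hi : ∀ a b, HasAllMoments (fun ω => (smean (fun j => Y j ω) a - m a) * m a
      * ((smean (fun j => Y j ω) b - m b) * m b)) P := fun a b =>
    ((h.mean_allMoments hn a).mul (.const _)).mul ((h.mean_allMoments hn b).mul (.const _))
  simp only [crossGap, pow_two, Finset.sum_mul_sum]
  rw [integral_finsetSum _ fun a _ => (HasAllMoments.sum _ fun b _ => hi a b).integrable]
  simp_rw [integral_finsetSum _ fun b _ => (hi _ b).integrable]
  have e : ∀ a b, ∫ ω, (smean (fun j => Y j ω) a - m a) * m a
      * ((smean (fun j => Y j ω) b - m b) * m b) ∂P = (n : ℝ)⁻¹ * Sig a b * (m a * m b) := by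
    intro a b
    rw [← h.integral_mean_mul hn a b, ← integral_mul_const]
    congr 1
    funext ω
    ring
  simp_rw [e, dotProduct, mulVec, dotProduct, Finset.mul_sum]
  refine Finset.sum_congr rfl fun a _ => Finset.sum_congr rfl fun b _ => ?_
  ring

end IsGaussianSample

end GapStatistics

/-! ### Second moments of the statistics -/

section SecondMoments

variable {ι : Type*} [Fintype ι] {n : ℕ}

lemma abs_le_trace_of_posDef {Sig : Matrix ι ι ℝ} (hS : Sig.PosDef) (a b : ι) :
    |Sig a b| ≤ Sig.trace := by
  classical
  have hdiag : ∀ a, 0 ≤ Sig a a := fun a => hS.posSemidef.diag_nonneg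
  have hle : ∀ a, Sig a a ≤ Sig.trace := fun a =>
    Finset.single_le_sum (f := fun a => Sig a a) (fun a _ => hdiag a) (Finset.mem_univ a)
  have hsymm : Sig b a = Sig a b := by simpa using hS.isHermitian.apply a b
  have key : ∀ t : ℝ, 0 ≤ Sig a a + 2 * t * Sig a b + t ^ 2 * Sig b b := by
    intro t
    have := hS.posSemidef.dotProduct_mulVec_nonneg (Pi.single a 1 + t • Pi.single b 1)
    simp [mulVec_add, mulVec_smul, hsymm] at this
    linarith
  have h1 := key 1
  have h2 := key (-1)
  have := hle a
  have := hle b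
  rw [abs_le]
  constructor <;> linarith

lemma abs_scat_le_energy (hn : n ≠ 0) (m : EuclideanSpace ℝ ι) (y : Fin n → EuclideanSpace ℝ ι)
    (a b : ι) : |scat y a b| ≤ energy m y := by
  refine abs_le_of_sq_le_sq ?_ (energy_nonneg m y)
  refine le_trans ?_ (sum_scat_sq_le_energy hn m y)
  refine le_trans ?_ (Finset.single_le_sum (f := fun a => ∑ b, scat y a b ^ 2)
    (fun a _ => Finset.sum_nonneg fun b _ => sq_nonneg _) (Finset.mem_univ a))
  exact Finset.single_le_sum (f := fun b => scat y a b ^ 2) (fun b _ => sq_nonneg _)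
    (Finset.mem_univ b)

/-- All statistics but `crossGap` are at most quadratic in the energy and in the covariance. -/
lemma exists_abs_gapStat_le (hn : 3 ≤ n) (ι : Type*) [Fintype ι] :
    ∃ D : ℝ, 0 ≤ D ∧ ∀ (m : EuclideanSpace ℝ ι) (Sig : Matrix ι ι ℝ), Sig.PosDef →
      ∀ (y : Fin n → EuclideanSpace ℝ ι) (k : GapIdx ι),
        gapStat (n := n) m Sig k = crossGap m ∨
        |gapStat m Sig k y| ≤ D * (1 + energy m y ^ 2 + Sig.trace ^ 2) := by
  have hn0 : n ≠ 0 := by omega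
  have hnR : (3 : ℝ) ≤ n := by exact_mod_cast hn
  set q : ℝ := (Fintype.card ι : ℝ) with hq
  have hq0 : 0 ≤ q := by positivity
  set A : ℝ := |((n : ℝ) - 3) / (((n : ℝ) + 1) * ((n : ℝ) - 2))|
  set B : ℝ := |((n : ℝ) - 1) / (((n : ℝ) + 1) * ((n : ℝ) - 2))|
  set A' : ℝ := |1 / (((n : ℝ) + 1) * ((n : ℝ) - 2))|
  set B' : ℝ := |1 / (((n : ℝ) - 1) * ((n : ℝ) + 1) * ((n : ℝ) - 2))|
  have hA : 0 ≤ A := abs_nonneg _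
  have hB : 0 ≤ B := abs_nonneg _
  have hA' : 0 ≤ A' := abs_nonneg _
  have hB' : 0 ≤ B' := abs_nonneg _
  refine ⟨2 + (A + B + q ^ 2 * (2 * n ^ 2)) + q ^ 2 * n + (A' + B' + q ^ 2) + n, by positivity, ?_⟩
  intro m Sig hS y k
  set R := energy m y with hR
  set s := Sig.trace with hs
  set G : ℝ := 1 + R ^ 2 + s ^ 2 with hG
  have hR0 : 0 ≤ R := energy_nonneg m y
  have hs0 : 0 ≤ s := hS.posSemidef.trace_nonneg
  have hG0 : 0 ≤ G := by positivity
  have hRG : R ≤ G := by nlinarith [sq_nonneg (R - 1), sq_nonneg s]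
  have hsG : s ≤ G := by nlinarith [sq_nonneg (s - 1), sq_nonneg R]
  have hsRG : s * R ≤ G := by nlinarith [sq_nonneg (R - s), sq_nonneg R, sq_nonneg s]
  have hR2G : R ^ 2 ≤ G := by linarith [sq_nonneg s]
  have hs2G : s ^ 2 ≤ G := by linarith [sq_nonneg R]
  have hG1 : G ≤ G ^ 2 := le_self_pow₀ (by linarith [sq_nonneg R, sq_nonneg s]) two_ne_zero
  have htr0 : 0 ≤ ∑ a, scat y a a := Finset.sum_nonneg fun a _ => scat_self_nonneg y a
  have htr : ∑ a, scat y a a ≤ R := trace_scat_le_energy hn0 m y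
  have htr2 : (∑ a, scat y a a) ^ 2 ≤ G := (pow_le_pow_left₀ htr0 htr 2).trans hR2G
  have hs2 : ∑ a, ∑ b, scat y a b ^ 2 ≤ G := (sum_scat_sq_le_energy hn0 m y).trans hR2G
  have hs20 : 0 ≤ ∑ a, ∑ b, scat y a b ^ 2 :=
    Finset.sum_nonneg fun a _ => Finset.sum_nonneg fun b _ => sq_nonneg _
  have hw : ∑ a, (smean y a - m a) ^ 2 ≤ R := sum_mean_sq_le_energy hn0 m y
  have hw0 : 0 ≤ ∑ a, (smean y a - m a) ^ 2 := Finset.sum_nonneg fun a _ => sq_nonneg _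
  have hT : ∀ a b, |scatGap Sig y a b| ≤ R + (n - 1) * s := by
    intro a b
    refine (abs_sub _ _).trans (add_le_add (abs_scat_le_energy hn0 m y a b) ?_)
    rw [abs_mul, abs_of_nonneg (by linarith : (0 : ℝ) ≤ n - 1)]
    exact mul_le_mul_of_nonneg_left (abs_le_trace_of_posDef hS a b) (by linarith)
  have hcard : ∀ (f : ι → ι → ℝ) (c : ℝ), (∀ a b, |f a b| ≤ c) → |∑ a, ∑ b, f a b| ≤ q ^ 2 * c := by
    intro f c hf
    calc |∑ a, ∑ b, f a b| ≤ ∑ a, ∑ b, |f a b| :=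
          (Finset.abs_sum_le_sum_abs _ _).trans
            (Finset.sum_le_sum fun a _ => Finset.abs_sum_le_sum_abs _ _)
      _ ≤ ∑ _a : ι, ∑ _b : ι, c := Finset.sum_le_sum fun a _ => Finset.sum_le_sum fun b _ => hf a b
      _ = q ^ 2 * c := by simp [hq]; ring
  have hT2 : ∀ a b, |scatGap Sig y a b ^ 2| ≤ 2 * n ^ 2 * G := by
    intro a b
    rw [abs_pow]
    refine (pow_le_pow_left₀ (abs_nonneg _) (hT a b) 2).trans ?_
    have h1 : (R + (n - 1) * s) ^ 2 ≤ 2 * R ^ 2 + 2 * ((n - 1) ^ 2 * s ^ 2) := by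
      nlinarith [sq_nonneg (R - (n - 1) * s)]
    have h2 : ((n : ℝ) - 1) ^ 2 * s ^ 2 ≤ n ^ 2 * s ^ 2 := by
      gcongr
      · linarith
      · linarith
    have h3 : R ^ 2 ≤ n ^ 2 * R ^ 2 :=
      le_mul_of_one_le_left (sq_nonneg R) (one_le_pow₀ (by linarith))
    have h4 : (0 : ℝ) ≤ n ^ 2 := by positivity
    have h5 : 2 * (n : ℝ) ^ 2 * G = 2 * n ^ 2 + 2 * (n ^ 2 * R ^ 2) + 2 * (n ^ 2 * s ^ 2) := by
      rw [hG]; ring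
    linarith
  have hlift : ∀ (x D' : ℝ), |x| ≤ D' * G → D' ≤ 2 + (A + B + q ^ 2 * (2 * n ^ 2)) + q ^ 2 * n +
      (A' + B' + q ^ 2) + n → |x| ≤ (2 + (A + B + q ^ 2 * (2 * n ^ 2)) + q ^ 2 * n +
      (A' + B' + q ^ 2) + n) * G := fun x D' h1 h2 => h1.trans (by gcongr)
  have hp1 : (0 : ℝ) ≤ q ^ 2 * (2 * n ^ 2) := by positivity
  have hp2 : (0 : ℝ) ≤ q ^ 2 * n := by positivity
  have hp3 : (0 : ℝ) ≤ q ^ 2 := by positivity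
  have hcomb : ∀ (α β : ℝ), |α * ∑ a, ∑ b, scat y a b ^ 2| ≤ |α| * G ∧
      |β * (∑ a, scat y a a) ^ 2| ≤ |β| * G := by
    intro α β
    rw [abs_mul, abs_mul, abs_of_nonneg hs20, abs_of_nonneg (sq_nonneg (∑ a, scat y a a))]
    constructor <;> gcongr
  refine forall_gapStat (p := fun f => f = crossGap m ∨ |f y| ≤ _) (Or.inr ?_) (Or.inl rfl)
    (Or.inr ?_) (Or.inr ?_) (Or.inr ?_) (fun a => Or.inr ?_) (fun a b => Or.inr ?_) k
  · refine hlift _ 2 ?_ (by linarith)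
    unfold normGap
    have h1 : (∑ a, scat y a a) / (n * ((n : ℝ) - 1)) ≤ R := by
      have hnn : (1 : ℝ) ≤ n * ((n : ℝ) - 1) := by nlinarith
      exact (div_le_self htr0 hnn).trans htr
    have h2 : 0 ≤ (∑ a, scat y a a) / (n * ((n : ℝ) - 1)) := div_nonneg htr0 (by nlinarith)
    rw [abs_le]
    constructor <;> linarith
  · refine hlift _ (A + B + q ^ 2 * (2 * n ^ 2)) ?_ (by linarith)
    unfold covGapZero
    refine (abs_sub _ _).trans ?_
    rw [add_mul (A + B)]
    refine add_le_add ((abs_add_le _ _).trans ?_) ?_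
    · rw [add_mul A]
      exact add_le_add (hcomb _ 0).1 (hcomb 0 _).2
    · rw [mul_assoc]
      exact hcard _ _ hT2
  · refine hlift _ (q ^ 2 * n) ?_ (by linarith)
    unfold covGapOne
    rw [mul_assoc]
    refine hcard _ _ fun a b => ?_
    rw [abs_mul]
    calc |Sig a b| * |scatGap Sig y a b| ≤ s * (R + (n - 1) * s) :=
          mul_le_mul (abs_le_trace_of_posDef hS a b) (hT a b) (abs_nonneg _) hs0
      _ = s * R + (n - 1) * s ^ 2 := by ring
      _ ≤ G + (n - 1) * G :=
          add_le_add hsRG (mul_le_mul_of_nonneg_left hs2G (by linarith))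
      _ = n * G := by ring
  · refine hlift _ (A' + B' + q ^ 2) ?_ (by linarith)
    unfold covGapTwo
    refine (abs_sub _ _).trans ?_
    rw [add_mul (A' + B')]
    refine add_le_add ((abs_sub _ _).trans ?_) ?_
    · rw [add_mul A']
      exact add_le_add (hcomb _ 0).1 (hcomb 0 _).2
    · refine hcard _ _ fun a b => ?_
      rw [abs_pow]
      refine (pow_le_pow_left₀ (abs_nonneg _) (abs_le_trace_of_posDef hS a b) 2).trans ?_
      exact hs2G
  · refine hlift _ 1 ?_ (by linarith)
    rw [one_mul]
    have h1 : (smean y a - m a) ^ 2 ≤ R := (Finset.single_le_sum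
      (f := fun a => (smean y a - m a) ^ 2) (fun a _ => sq_nonneg _) (Finset.mem_univ a)).trans hw
    refine abs_le_of_sq_le_sq ?_ hG0
    linarith
  · refine hlift _ n ((hT a b).trans ?_) (by linarith)
    calc R + (n - 1) * s ≤ G + (n - 1) * G :=
          add_le_add hRG (mul_le_mul_of_nonneg_left hsG (by linarith))
      _ = n * G := by ring

/-- The second moment of every statistic is controlled by the quantities whose averages are assumed
to be bounded; only `crossGap` needs the last one. -/
lemma exists_integral_gapStat_sq_le (hn : 3 ≤ n) (ι : Type*) [Fintype ι] [DecidableEq ι] :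
    ∃ C : ℝ, 0 ≤ C ∧ ∀ {Ω : Type*} [MeasurableSpace Ω] (P : Measure Ω) [IsProbabilityMeasure P]
      (Y : Fin n → Ω → EuclideanSpace ℝ ι) (m : EuclideanSpace ℝ ι) (Sig : Matrix ι ι ℝ),
      IsGaussianSample Y m Sig P → ∀ k : GapIdx ι,
      ∫ ω, gapStat m Sig k (fun j => Y j ω) ^ 2 ∂P
        ≤ C * (1 + Sig.trace ^ 4 + m.ofLp ⬝ᵥ (Sig *ᵥ m.ofLp)) := by
  have hn0 : n ≠ 0 := by omega
  have hnR : (3 : ℝ) ≤ n := by exact_mod_cast hn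
  obtain ⟨C₄, hC₄, h4⟩ := exists_integral_energy_pow_four_le n ι
  obtain ⟨D, hD, hbound⟩ := exists_abs_gapStat_le hn ι
  refine ⟨3 * D ^ 2 * (1 + C₄) + 1, by positivity, ?_⟩
  intro Ω _ P _ Y m Sig h k
  obtain ⟨hRm, hR4⟩ := h4 P Y m Sig h
  have hv0 : 0 ≤ m.ofLp ⬝ᵥ (Sig *ᵥ m.ofLp) := by
    simpa using h.posDef.posSemidef.dotProduct_mulVec_nonneg m.ofLp
  have hs0 : 0 ≤ Sig.trace ^ 4 := by
    have := h.posDef.posSemidef.trace_nonneg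
    positivity
  by_cases hk : gapStat (n := n) m Sig k = crossGap m
  · rw [hk, h.integral_crossGap_sq hn0]
    have h1 : (n : ℝ)⁻¹ ≤ 1 := inv_le_one_of_one_le₀ (by linarith)
    have h2 : (n : ℝ)⁻¹ * (m.ofLp ⬝ᵥ (Sig *ᵥ m.ofLp)) ≤ 1 * (m.ofLp ⬝ᵥ (Sig *ᵥ m.ofLp)) := by
      gcongr
    have h3 : 0 ≤ 3 * D ^ 2 * (1 + C₄) := by positivity
    nlinarith
  · have hb : ∀ ω, gapStat m Sig k (fun j => Y j ω) ^ 2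
        ≤ 3 * D ^ 2 * (1 + Sig.trace ^ 4 + energy m (fun j => Y j ω) ^ 4) := by
      intro ω
      have h1 := (hbound m Sig h.posDef (fun j => Y j ω) k).resolve_left hk
      rw [← sq_abs]
      refine (pow_le_pow_left₀ (abs_nonneg _) h1 2).trans ?_
      set R := energy m (fun j => Y j ω)
      have : (1 + R ^ 2 + Sig.trace ^ 2) ^ 2 ≤ 3 * (1 + Sig.trace ^ 4 + R ^ 4) := by
        nlinarith [sq_nonneg (1 - R ^ 2), sq_nonneg (1 - Sig.trace ^ 2),
          sq_nonneg (R ^ 2 - Sig.trace ^ 2)]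
      rw [mul_pow]
      nlinarith [sq_nonneg D]
    have hI : HasAllMoments (fun ω => 1 + Sig.trace ^ 4 + energy m (fun j => Y j ω) ^ 4) P :=
      (HasAllMoments.const _).add (hRm.pow 4)
    calc ∫ ω, gapStat m Sig k (fun j => Y j ω) ^ 2 ∂P
        ≤ ∫ ω, 3 * D ^ 2 * (1 + Sig.trace ^ 4 + energy m (fun j => Y j ω) ^ 4) ∂P :=
          integral_mono ((h.gapStat_allMoments hn0 k).pow 2).integrable
            (hI.const_mul _).integrable hb
      _ = 3 * D ^ 2 * (1 + Sig.trace ^ 4 + ∫ ω, energy m (fun j => Y j ω) ^ 4 ∂P) := by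
          rw [integral_const_mul, integral_add (integrable_const _) (hRm.pow 4).integrable]
          simp
      _ ≤ 3 * D ^ 2 * (1 + Sig.trace ^ 4 + C₄ * Sig.trace ^ 4) := by gcongr
      _ ≤ _ := by
          have e1 : 0 ≤ 3 * D ^ 2 := by positivity
          have e2 : 0 ≤ 3 * D ^ 2 * C₄ := by positivity
          have e3 : 0 ≤ 3 * D ^ 2 * (1 + C₄) * (m.ofLp ⬝ᵥ (Sig *ᵥ m.ofLp)) := by positivity
          nlinarith

end SecondMoments

/-! ### The matrix logarithm and the vectorisation -/

section MatrixLog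

variable {N : ℕ}

lemma matLog_isHermitian (X : Matrix (Fin N) (Fin N) ℝ) : (matLog X).IsHermitian :=
  cfc_predicate (p := IsSelfAdjoint) Real.log X

open scoped Matrix.Norms.Frobenius in
lemma matLog_matExp {A : Matrix (Fin N) (Fin N) ℝ} (hA : A.IsHermitian) :
    matLog (matExp A) = A :=
  @CFC.log_exp (Matrix (Fin N) (Fin N) ℝ) _ _ _ Matrix.IsHermitian.instContinuousFunctionalCalculus
    A hA

open scoped Matrix.Norms.Frobenius MatrixOrder in
lemma matExp_matLog {X : Matrix (Fin N) (Fin N) ℝ} (hX : X.PosDef) : matExp (matLog X) = X :=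
  @CFC.exp_log (Matrix (Fin N) (Fin N) ℝ) _ _ _ Matrix.IsHermitian.instContinuousFunctionalCalculus
    _ _ _ X hX.isStrictlyPositive

open scoped Matrix.Norms.Frobenius in
lemma continuous_matExp : Continuous (matExp : Matrix (Fin N) (Fin N) ℝ → _) :=
  NormedSpace.exp_continuous

/-- The matrix logarithm is measurable on positive definite matrices: it is the inverse of the
exponential, a continuous injection on the closed set of symmetric matrices. -/
lemma measurable_matLog : Measurable fun X : SPD (Fin N) => matLog X.1 := by
  have hcl : IsClosed {A : Matrix (Fin N) (Fin N) ℝ | A.IsHermitian} :=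
    isClosed_eq (by fun_prop) continuous_id
  have : PolishSpace {A : Matrix (Fin N) (Fin N) ℝ // A.IsHermitian} := by
    have : PolishSpace (Matrix (Fin N) (Fin N) ℝ) :=
      inferInstanceAs (PolishSpace (Fin N → Fin N → ℝ))
    exact hcl.polishSpace
  have hemb : MeasurableEmbedding
      (fun A : {A : Matrix (Fin N) (Fin N) ℝ // A.IsHermitian} => matExp A.1) :=
    (continuous_matExp.comp continuous_subtype_val).measurableEmbedding fun A B hAB => by
      have := congrArg matLog hAB
      simpa [matLog_matExp A.2, matLog_matExp B.2, Subtype.ext_iff] using this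
  have hmeas : Measurable fun X : SPD (Fin N) =>
      (⟨matLog X.1, matLog_isHermitian X.1⟩ : {A : Matrix (Fin N) (Fin N) ℝ // A.IsHermitian}) := by
    rw [← hemb.measurable_comp_iff]
    have : (fun X : SPD (Fin N) => matExp (matLog X.1)) = Subtype.val :=
      funext fun X => matExp_matLog X.2
    change Measurable fun X : SPD (Fin N) => matExp (matLog X.1)
    rw [this]
    exact measurable_subtype_coe
  exact measurable_subtype_coe.comp hmeas

lemma measurable_tildeVec : Measurable fun X : SPD (Fin N) => tildeVec X.1 := by
  have h : ∀ i j, Measurable fun X : SPD (Fin N) => matLog X.1 i j := fun i j =>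
    (measurable_pi_apply j).comp ((measurable_pi_apply i).comp measurable_matLog)
  refine (PiLp.continuous_toLp 2 _).measurable.comp (measurable_pi_lambda _ fun a => ?_)
  rcases a with i | ij
  · exact h i i
  · exact (h _ _).const_mul _

lemma frobNorm_sq {κ : Type*} [Fintype κ] (A : Matrix κ κ ℝ) :
    frobNorm A ^ 2 = ∑ a, ∑ b, A a b ^ 2 := by
  have h0 : 0 ≤ ∑ a, ∑ b, A a b ^ 2 :=
    Finset.sum_nonneg fun a _ => Finset.sum_nonneg fun b _ => sq_nonneg _
  rw [frobNorm, Matrix.frobenius_norm_def]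
  simp only [Real.norm_eq_abs, Real.rpow_two, sq_abs]
  rw [← Real.sqrt_eq_rpow, Real.sq_sqrt h0]

lemma frobNorm_nonneg {κ : Type*} [Fintype κ] (A : Matrix κ κ ℝ) : 0 ≤ frobNorm A := by
  rw [frobNorm, Matrix.frobenius_norm_def]
  positivity

/-- The vectorisation is an isometry on symmetric matrices. -/
lemma sum_vecSym_sq {A : Matrix (Fin N) (Fin N) ℝ} (hA : A.IsHermitian) :
    ∑ a, vecSym A a ^ 2 = frobNorm A ^ 2 := by
  have hs : ∀ i j, A j i = A i j := fun i j => by simpa using hA.apply i j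
  rw [frobNorm_sq, Fintype.sum_sum_type]
  simp only [vecSym, Sum.elim_inl, Sum.elim_inr, mul_pow, Real.sq_sqrt zero_le_two]
  have h1 : ∑ x : {ij : Fin N × Fin N // ij.1 < ij.2}, 2 * A x.1.1 x.1.2 ^ 2
      = ∑ i, ∑ j, if i < j then 2 * A i j ^ 2 else 0 := by
    rw [← Fintype.sum_prod_type' (f := fun i j => if i < j then 2 * A i j ^ 2 else 0),
      ← Finset.sum_filter]
    exact (Finset.sum_subtype (p := fun ij : Fin N × Fin N => ij.1 < ij.2) _ (by simp)
      (fun ij => 2 * A ij.1 ij.2 ^ 2)).symm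
  have h2 : ∑ i, ∑ j, (if i < j then A i j ^ 2 else 0)
      = ∑ i, ∑ j, if j < i then A i j ^ 2 else 0 := by
    rw [Finset.sum_comm]
    refine Finset.sum_congr rfl fun i _ => Finset.sum_congr rfl fun j _ => ?_
    rw [hs]
  have h3 : ∀ i j, A i j ^ 2 = (if i = j then A i j ^ 2 else 0)
      + ((if i < j then A i j ^ 2 else 0) + if j < i then A i j ^ 2 else 0) := by
    intro i j
    rcases lt_trichotomy i j with h | h | h
    · simp [h, h.ne, h.not_gt]
    · simp [h]
    · simp [h, h.ne', h.not_gt]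
  rw [h1]
  have h4 : ∑ i, ∑ j, A i j ^ 2 = ∑ i, ∑ j, (if i = j then A i j ^ 2 else 0)
      + (∑ i, ∑ j, (if i < j then A i j ^ 2 else 0)
        + ∑ i, ∑ j, if j < i then A i j ^ 2 else 0) := by
    simp only [← Finset.sum_add_distrib, ← h3]
  rw [h4, ← h2]
  simp only [Finset.sum_ite_eq, Finset.mem_univ, if_true, ← Finset.sum_add_distrib]
  refine Finset.sum_congr rfl fun i _ => ?_
  congr 1
  refine Finset.sum_congr rfl fun j _ => ?_
  split_ifs <;> ring

end MatrixLog

/-! ### The gap as a linear combination of the centred statistics -/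

section GapIdentity

variable {N n : ℕ}

lemma matLog_sampleFM (x : Fin n → SPD (Fin N)) :
    matLog (sampleFM x) = (n : ℝ)⁻¹ • ∑ j, matLog (x j).1 := by
  refine matLog_matExp ?_
  have h : ∀ j, (matLog (x j).1)ᵀ = matLog (x j).1 := fun j => by
    simpa using (matLog_isHermitian (x j).1).eq
  simp [IsHermitian, transpose_sum, h]

lemma tildeVec_sampleFM (x : Fin n → SPD (Fin N)) (a : SymIdx N) :
    tildeVec (sampleFM x) a = smean (fun j => tildeVec (x j).1) a := by
  rcases a with i | ij
  · simp [tildeVec, vecSym, smean, matLog_sampleFM, Matrix.sum_apply]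
  · simp only [tildeVec, vecSym, smean, matLog_sampleFM, Matrix.smul_apply, Matrix.sum_apply,
      Sum.elim_inr, smul_eq_mul, ← Finset.mul_sum]
    ring

lemma scatter_apply (x : Fin n → SPD (Fin N)) (a b : SymIdx N) :
    scatter x a b = scat (fun j => tildeVec (x j).1) a b := by
  simp [scatter, scat, Matrix.sum_apply, vecMulVec_apply, tildeVec_sampleFM]

lemma distLE_sq (A B : Matrix (Fin N) (Fin N) ℝ) :
    distLE A B ^ 2 = ∑ a, (tildeVec A a - tildeVec B a) ^ 2 := by
  rw [distLE, ← sum_vecSym_sq ((matLog_isHermitian A).sub (matLog_isHermitian B))]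
  refine Finset.sum_congr rfl fun a _ => ?_
  rcases a with i | ij
  · simp [tildeVec, vecSym]
  · simp [tildeVec, vecSym, mul_sub]

lemma frobNorm_matLog_sq (A : Matrix (Fin N) (Fin N) ℝ) :
    frobNorm (matLog A) ^ 2 = ∑ a, tildeVec A a ^ 2 :=
  (sum_vecSym_sq (matLog_isHermitian A)).symm

lemma tildeVec_shrinkMean (lam : ℝ) (mu : SPD (Fin N)) (x : Fin n → SPD (Fin N)) (a : SymIdx N) :
    tildeVec (shrinkMean lam mu x) a
      = (lam + n)⁻¹ * (n * smean (fun j => tildeVec (x j).1) a + lam * tildeVec mu.1 a) := by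
  have h : matLog (shrinkMean lam mu x)
      = (lam + n)⁻¹ • ((n : ℝ) • matLog (sampleFM x) + lam • matLog mu.1) := by
    refine matLog_matExp ?_
    have h1 : (matLog (sampleFM x))ᵀ = matLog (sampleFM x) := by
      simpa using (matLog_isHermitian (sampleFM x)).eq
    have h2 : (matLog mu.1)ᵀ = matLog mu.1 := by simpa using (matLog_isHermitian mu.1).eq
    simp [IsHermitian, h1, h2]
  rw [← tildeVec_sampleFM]
  rcases a with i | ij
  · simp [tildeVec, vecSym, h]
  · simp only [tildeVec, vecSym, h, Matrix.smul_apply, Matrix.add_apply, Sum.elim_inr, smul_eq_mul]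
    ring

/-- The part of the gap that comes from estimating the mean. -/
lemma mean_gap_identity {ι : Type*} [Fintype ι] (hn : 3 ≤ n) {lam : ℝ} (hlam : 0 < lam)
    (m u : EuclideanSpace ℝ ι) (y : Fin n → EuclideanSpace ℝ ι) :
    ((lam + n) ^ 2)⁻¹ * (((n : ℝ) - lam ^ 2 / n) / ((n : ℝ) - 1) * (∑ a, scat y a a)
        + lam ^ 2 * ∑ a, (smean y a - u a) ^ 2)
      - ∑ a, ((lam + n)⁻¹ * (n * smean y a + lam * u a) - m a) ^ 2
    = (n - lam) / (n + lam) * normGap m y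
      - 2 * (lam / (lam + n)) * (∑ a, (smean y a - m a) * u a - crossGap m y) := by
  have hnR : (3 : ℝ) ≤ n := by exact_mod_cast hn
  have d0 : (n : ℝ) ≠ 0 := by linarith
  have d1 : (n : ℝ) - 1 ≠ 0 := by linarith
  have d2 : lam + n ≠ 0 := by linarith
  have d3 : n + lam ≠ 0 := by linarith
  have e1 : ∑ a, (smean y a - u a) ^ 2 = ∑ a, (smean y a - m a) ^ 2
      - 2 * (∑ a, (smean y a - m a) * u a - crossGap m y) + ∑ a, (u a - m a) ^ 2 := by
    simp only [crossGap, ← Finset.sum_sub_distrib, Finset.mul_sum, ← Finset.sum_add_distrib]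
    exact Finset.sum_congr rfl fun a _ => by ring
  have e2 : ∑ a, ((lam + n)⁻¹ * (n * smean y a + lam * u a) - m a) ^ 2
      = ((lam + n) ^ 2)⁻¹ * (n ^ 2 * ∑ a, (smean y a - m a) ^ 2
        + 2 * n * lam * (∑ a, (smean y a - m a) * u a - crossGap m y)
        + lam ^ 2 * ∑ a, (u a - m a) ^ 2) := by
    simp only [crossGap, ← Finset.sum_sub_distrib, Finset.mul_sum, ← Finset.sum_add_distrib]
    refine Finset.sum_congr rfl fun a _ => ?_
    field_simp
    ring
  rw [e1, e2, normGap]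
  field_simp
  ring

/-- The part of the gap that comes from estimating the covariance; `t` stands for `ν - q - 1`. -/
lemma cov_gap_identity {ι : Type*} [Fintype ι] (hn : 3 ≤ n) {t : ℝ} (ht : 0 < t)
    {Sig Psi : Matrix ι ι ℝ} (y : Fin n → EuclideanSpace ℝ ι) :
    ((t + (n - 1)) ^ 2)⁻¹ * (((n : ℝ) - 3 + t ^ 2) / (((n : ℝ) + 1) * ((n : ℝ) - 2))
          * (∑ a, ∑ b, scat y a b ^ 2)
        + (((n : ℝ) - 1) ^ 2 - t ^ 2) / (((n : ℝ) - 1) * ((n : ℝ) + 1) * ((n : ℝ) - 2))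
          * (∑ a, scat y a a) ^ 2
        - 2 * (t / ((n : ℝ) - 1)) * (∑ a, ∑ b, Psi a b * scat y a b) + ∑ a, ∑ b, Psi a b ^ 2)
      - ∑ a, ∑ b, ((t + (n - 1))⁻¹ * (Psi a b + scat y a b) - Sig a b) ^ 2
    = ((t + (n - 1)) ^ 2)⁻¹ * covGapZero Sig y + 2 * (t / (t + (n - 1)) ^ 2) * covGapOne Sig y
      + t ^ 2 / (t + (n - 1)) ^ 2 * covGapTwo Sig y
      - 2 / ((t + (n - 1)) * (n - 1)) * ∑ a, ∑ b, Psi a b * scatGap Sig y a b := by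
  have hnR : (3 : ℝ) ≤ n := by exact_mod_cast hn
  have d1 : (n : ℝ) - 1 ≠ 0 := by linarith
  have d2 : (n : ℝ) - 2 ≠ 0 := by linarith
  have d3 : (n : ℝ) + 1 ≠ 0 := by linarith
  have d4 : t + ((n : ℝ) - 1) ≠ 0 := by linarith
  have e1 : ∑ a, ∑ b, ((t + (n - 1))⁻¹ * (Psi a b + scat y a b) - Sig a b) ^ 2
      = ((t + ((n : ℝ) - 1)) ^ 2)⁻¹ * (∑ a, ∑ b, Psi a b ^ 2 + t ^ 2 * ∑ a, ∑ b, Sig a b ^ 2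
        + ∑ a, ∑ b, scatGap Sig y a b ^ 2 - 2 * t * ∑ a, ∑ b, Psi a b * Sig a b
        + 2 * ∑ a, ∑ b, Psi a b * scatGap Sig y a b - 2 * t * covGapOne Sig y) := by
    simp only [covGapOne, Finset.mul_sum, ← Finset.sum_add_distrib, ← Finset.sum_sub_distrib]
    refine Finset.sum_congr rfl fun a _ => Finset.sum_congr rfl fun b _ => ?_
    rw [scatGap]
    field_simp
    ring
  have e2 : ∑ a, ∑ b, Psi a b * Sig a b = ((n : ℝ) - 1)⁻¹ *
      (∑ a, ∑ b, Psi a b * scat y a b - ∑ a, ∑ b, Psi a b * scatGap Sig y a b) := by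
    simp only [Finset.mul_sum, ← Finset.sum_sub_distrib]
    refine Finset.sum_congr rfl fun a _ => Finset.sum_congr rfl fun b _ => ?_
    rw [scatGap]
    field_simp
    ring
  rw [e1, e2, covGapZero, covGapTwo]
  field_simp
  ring

/-- The average over `i < p` of a statistic of the `i`-th sample. -/
noncomputable def avgGap {ι : Type*} [Fintype ι] (p : ℕ) (m : ℕ → EuclideanSpace ℝ ι)
    (Sig : ℕ → Matrix ι ι ℝ) (y : ℕ → Fin n → EuclideanSpace ℝ ι) (k : GapIdx ι) : ℝ :=
  (p : ℝ)⁻¹ * ∑ i ∈ Finset.range p, gapStat (m i) (Sig i) k (y i)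

/-- The difference between risk estimate and loss is a combination of averages of centred
statistics, with coefficients that depend on the hyperparameters only. -/
lemma sure_sub_totalLoss (hn : 3 ≤ n) (p : ℕ) (x : ℕ → Fin n → SPD (Fin N))
    (M : ℕ → SPD (Fin N)) (Sig : ℕ → SPD (SymIdx N)) {lam nu : ℝ} (hlam : 0 < lam)
    (hnu : symDim N + 1 < nu) (Psi : SPD (SymIdx N)) (mu : SPD (Fin N)) :
    let A := avgGap p (fun i => tildeVec (M i).1) (fun i => (Sig i).1)
      (fun i j => tildeVec (x i j).1)
    let t := nu - symDim N - 1
    sure p x lam Psi nu mu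
      - totalLoss p (fun i => shrinkMean lam mu (x i)) (fun i => shrinkCov Psi nu (x i)) M Sig
    = (n - lam) / (n + lam) * A (.inl 0)
      - 2 * (lam / (lam + n)) * (∑ a, A (.inr (.inl a)) * tildeVec mu.1 a - A (.inl 1))
      + (((t + (n - 1)) ^ 2)⁻¹ * A (.inl 2) + 2 * (t / (t + (n - 1)) ^ 2) * A (.inl 3)
        + t ^ 2 / (t + (n - 1)) ^ 2 * A (.inl 4)
        - 2 / ((t + (n - 1)) * (n - 1)) * ∑ a, ∑ b, Psi.1 a b * A (.inr (.inr (a, b)))) := by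
  intro A t
  have ht : 0 < t := by simp only [t]; linarith
  have hd : nu + n - symDim N - 2 = t + (n - 1) := by simp only [t]; ring
  have hPsi : ∀ a b, Psi.1 b a = Psi.1 a b := fun a b => by
    simpa using Psi.2.isHermitian.apply a b
  set y : ℕ → Fin n → EuclideanSpace ℝ (SymIdx N) := fun i j => tildeVec (x i j).1 with hy
  have htr : ∀ i, (scatter (x i)).trace = ∑ a, scat (y i) a a := fun i => by
    simp [trace, scatter_apply, hy]
  have htr2 : ∀ i, (scatter (x i) * scatter (x i)).trace = ∑ a, ∑ b, scat (y i) a b ^ 2 := by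
    intro i
    simp only [trace, diag_apply, mul_apply, scatter_apply]
    refine Finset.sum_congr rfl fun a _ => Finset.sum_congr rfl fun b _ => ?_
    rw [scat_comm _ b a, pow_two]
  have htrP : ∀ i, (Psi.1 * scatter (x i)).trace = ∑ a, ∑ b, Psi.1 a b * scat (y i) a b := by
    intro i
    simp only [trace, diag_apply, mul_apply, scatter_apply]
    refine Finset.sum_congr rfl fun a _ => Finset.sum_congr rfl fun b _ => ?_
    rw [scat_comm _ b a]
  have htrPP : (Psi.1 * Psi.1).trace = ∑ a, ∑ b, Psi.1 a b ^ 2 := by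
    simp only [trace, diag_apply, mul_apply]
    refine Finset.sum_congr rfl fun a _ => Finset.sum_congr rfl fun b _ => ?_
    rw [hPsi a b, pow_two]
  have key : sure p x lam Psi nu mu
      - totalLoss p (fun i => shrinkMean lam mu (x i)) (fun i => shrinkCov Psi nu (x i)) M Sig
      = (p : ℝ)⁻¹ * ∑ i ∈ Finset.range p,
        (((n - lam) / (n + lam) * normGap (tildeVec (M i).1) (y i)
          - 2 * (lam / (lam + n)) * (∑ a, (smean (y i) a - tildeVec (M i).1 a) * tildeVec mu.1 a
            - crossGap (tildeVec (M i).1) (y i)))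
        + (((t + (n - 1)) ^ 2)⁻¹ * covGapZero (Sig i).1 (y i)
          + 2 * (t / (t + (n - 1)) ^ 2) * covGapOne (Sig i).1 (y i)
          + t ^ 2 / (t + (n - 1)) ^ 2 * covGapTwo (Sig i).1 (y i)
          - 2 / ((t + (n - 1)) * (n - 1)) *
            ∑ a, ∑ b, Psi.1 a b * scatGap (Sig i).1 (y i) a b)) := by
    rw [sure, totalLoss, ← mul_add, ← mul_sub, ← Finset.sum_add_distrib, ← Finset.sum_sub_distrib]
    congr 1
    refine Finset.sum_congr rfl fun i _ => ?_
    rw [← mean_gap_identity hn hlam, ← cov_gap_identity hn ht, htr, htr2, htrP, htrPP, distLE_sq,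
      distLE_sq, frobNorm_sq, hd]
    simp only [tildeVec_sampleFM, tildeVec_shrinkMean, shrinkCov, Matrix.sub_apply,
      Matrix.smul_apply, Matrix.add_apply, smul_eq_mul, scatter_apply, hd]
    simp only [t, hy]
    ring
  have e1 : ∑ a, A (.inr (.inl a)) * tildeVec mu.1 a = (p : ℝ)⁻¹ * ∑ i ∈ Finset.range p,
      ∑ a, (smean (y i) a - tildeVec (M i).1 a) * tildeVec mu.1 a := by
    simp only [A, avgGap, gapStat, Sum.elim_inr, Sum.elim_inl, Finset.mul_sum, Finset.sum_mul]
    rw [Finset.sum_comm]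
    exact Finset.sum_congr rfl fun i _ => Finset.sum_congr rfl fun a _ => by ring
  have e2 : ∑ a, ∑ b, Psi.1 a b * A (.inr (.inr (a, b))) = (p : ℝ)⁻¹ * ∑ i ∈ Finset.range p,
      ∑ a, ∑ b, Psi.1 a b * scatGap (Sig i).1 (y i) a b := by
    simp only [A, avgGap, gapStat, Sum.elim_inr, Finset.mul_sum]
    symm
    rw [Finset.sum_comm]
    refine Finset.sum_congr rfl fun a _ => ?_
    rw [Finset.sum_comm]
    exact Finset.sum_congr rfl fun b _ => Finset.sum_congr rfl fun i _ => by ring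
  rw [key, e1, e2]
  simp only [A, avgGap, gapStat, Sum.elim_inl]
  simp only [Finset.sum_add_distrib, Finset.sum_sub_distrib, ← Finset.mul_sum]
  simp only [Matrix.cons_val]
  ring

end GapIdentity

/-! ### A bound for the gap that is uniform in the hyperparameters -/

section UniformBound

variable {N n : ℕ}

/-- The hyperparameters `λ` and `ν` enter only through bounded coefficients. -/
lemma abs_sure_sub_totalLoss_le (hn : 3 ≤ n) (p : ℕ) (x : ℕ → Fin n → SPD (Fin N))
    (M : ℕ → SPD (Fin N)) (Sig : ℕ → SPD (SymIdx N)) {lam nu : ℝ} (hlam : 0 < lam)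
    (hnu : symDim N + 1 < nu) (Psi : SPD (SymIdx N)) (mu : SPD (Fin N)) {K : ℝ}
    (hK : ∀ k, |avgGap p (fun i => tildeVec (M i).1) (fun i => (Sig i).1)
      (fun i j => tildeVec (x i j).1) k| ≤ K) :
    |sure p x lam Psi nu mu
      - totalLoss p (fun i => shrinkMean lam mu (x i)) (fun i => shrinkCov Psi nu (x i)) M Sig|
      ≤ K * (7 + 2 * ∑ a, |tildeVec mu.1 a| + ∑ a, ∑ b, |Psi.1 a b|) := by
  rw [sure_sub_totalLoss hn p x M Sig hlam hnu Psi mu]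
  set A := avgGap p (fun i => tildeVec (M i).1) (fun i => (Sig i).1)
    (fun i j => tildeVec (x i j).1) with hA
  set t := nu - symDim N - 1 with ht
  have ht0 : 0 < t := by simp only [ht]; linarith
  have hnR : (3 : ℝ) ≤ n := by exact_mod_cast hn
  have hK0 : 0 ≤ K := (abs_nonneg _).trans (hK (.inl 0))
  -- each coefficient is bounded, uniformly in the hyperparameters
  have hc : ∀ (c C z Z : ℝ), |c| ≤ C → |z| ≤ Z → |c * z| ≤ C * Z := fun c C z Z h1 h2 => by
    rw [abs_mul]
    exact mul_le_mul h1 h2 (abs_nonneg _) ((abs_nonneg _).trans h1)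
  have hd2 : (2 : ℝ) ≤ t + (n - 1) := by linarith
  have hd2' : t + 1 ≤ (t + ((n : ℝ) - 1)) ^ 2 := by nlinarith
  have hd2'' : t ^ 2 ≤ (t + ((n : ℝ) - 1)) ^ 2 := by nlinarith
  have hdpos : 0 < (t + ((n : ℝ) - 1)) ^ 2 := by positivity
  have c1 : |(n - lam) / (n + lam)| ≤ 1 := by
    rw [abs_div, abs_of_pos (by linarith : (0 : ℝ) < n + lam), div_le_one (by linarith), abs_le]
    constructor <;> linarith
  have c2 : |2 * (lam / (lam + n))| ≤ 2 := by
    have : lam / (lam + n) ≤ 1 := (div_le_one (by linarith)).2 (by linarith)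
    rw [abs_of_nonneg (by positivity)]
    linarith
  have c3 : |((t + ((n : ℝ) - 1)) ^ 2)⁻¹| ≤ 1 := by
    rw [abs_of_pos (by positivity)]
    exact inv_le_one_of_one_le₀ (by linarith)
  have c4 : |2 * (t / (t + ((n : ℝ) - 1)) ^ 2)| ≤ 2 := by
    have : t / (t + ((n : ℝ) - 1)) ^ 2 ≤ 1 := (div_le_one hdpos).2 (by linarith)
    rw [abs_of_nonneg (by positivity)]
    linarith
  have c5 : |t ^ 2 / (t + ((n : ℝ) - 1)) ^ 2| ≤ 1 := by
    rw [abs_of_nonneg (by positivity)]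
    exact (div_le_one hdpos).2 hd2''
  have c6 : |2 / ((t + ((n : ℝ) - 1)) * (n - 1))| ≤ 1 := by
    have h4 : (2 : ℝ) ≤ (t + (n - 1)) * (n - 1) := by nlinarith
    rw [abs_of_nonneg (div_nonneg zero_le_two (by linarith))]
    exact (div_le_one (by linarith)).2 h4
  have s1 : |∑ a, A (.inr (.inl a)) * tildeVec mu.1 a| ≤ K * ∑ a, |tildeVec mu.1 a| := by
    rw [Finset.mul_sum]
    exact (Finset.abs_sum_le_sum_abs _ _).trans
      (Finset.sum_le_sum fun a _ => hc _ _ _ _ (hK _) le_rfl)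
  have s2 : |∑ a, ∑ b, Psi.1 a b * A (.inr (.inr (a, b)))| ≤ K * ∑ a, ∑ b, |Psi.1 a b| := by
    simp only [Finset.mul_sum]
    refine (Finset.abs_sum_le_sum_abs _ _).trans (Finset.sum_le_sum fun a _ => ?_)
    refine (Finset.abs_sum_le_sum_abs _ _).trans (Finset.sum_le_sum fun b _ => ?_)
    rw [mul_comm K]
    exact hc _ _ _ _ le_rfl (hK _)
  have b1 := abs_le.1 (hc _ _ _ _ c1 (hK (.inl 0)))
  have b2 := abs_le.1 (hc _ _ _ _ c2 ((abs_sub (∑ a, A (.inr (.inl a)) * tildeVec mu.1 a)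
    (A (.inl 1))).trans (add_le_add s1 (hK (.inl 1)))))
  have b3 := abs_le.1 (hc _ _ _ _ c3 (hK (.inl 2)))
  have b4 := abs_le.1 (hc _ _ _ _ c4 (hK (.inl 3)))
  have b5 := abs_le.1 (hc _ _ _ _ c5 (hK (.inl 4)))
  have b6 := abs_le.1 (hc _ _ _ _ c6 s2)
  rw [abs_le]
  constructor <;> linarith

lemma abs_apply_le_frobNorm {κ : Type*} [Fintype κ] (A : Matrix κ κ ℝ) (a b : κ) :
    |A a b| ≤ frobNorm A := by
  refine abs_le_of_sq_le_sq ?_ (frobNorm_nonneg A)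
  rw [frobNorm_sq]
  exact (Finset.single_le_sum (f := fun b => A a b ^ 2) (fun _ _ => sq_nonneg _)
    (Finset.mem_univ b)).trans (Finset.single_le_sum (f := fun a => ∑ b, A a b ^ 2)
    (fun _ _ => Finset.sum_nonneg fun _ _ => sq_nonneg _) (Finset.mem_univ a))

lemma abs_tildeVec_le_frobNorm (A : Matrix (Fin N) (Fin N) ℝ) (a : SymIdx N) :
    |tildeVec A a| ≤ frobNorm (matLog A) := by
  refine abs_le_of_sq_le_sq ?_ (frobNorm_nonneg _)
  rw [frobNorm_matLog_sq]
  exact Finset.single_le_sum (f := fun a => tildeVec A a ^ 2) (fun _ _ => sq_nonneg _)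
    (Finset.mem_univ a)

lemma frobNorm_scatter_le (hn : n ≠ 0) (x : Fin n → SPD (Fin N))
    (m : EuclideanSpace ℝ (SymIdx N)) :
    frobNorm (scatter x) ≤ energy m (fun j => tildeVec (x j).1) := by
  refine le_of_sq_le_sq ?_ (energy_nonneg _ _)
  rw [frobNorm_sq]
  simp only [scatter_apply]
  exact sum_scat_sq_le_energy hn m _

lemma frobNorm_matLog_sampleFM_le (hn : n ≠ 0) (x : Fin n → SPD (Fin N)) (M : SPD (Fin N)) :
    frobNorm (matLog (sampleFM x))
      ≤ 2 * (1 + energy (tildeVec M.1) (fun j => tildeVec (x j).1) + frobNorm (matLog M.1)) := by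
  set R := energy (tildeVec M.1) (fun j => tildeVec (x j).1) with hR
  set b := frobNorm (matLog M.1) with hb
  have hR0 : 0 ≤ R := energy_nonneg _ _
  have hb0 : 0 ≤ b := frobNorm_nonneg _
  refine le_of_sq_le_sq ?_ (by positivity)
  rw [frobNorm_matLog_sq]
  calc ∑ a, tildeVec (sampleFM x) a ^ 2
      ≤ ∑ a, (2 * (smean (fun j => tildeVec (x j).1) a - tildeVec M.1 a) ^ 2
          + 2 * tildeVec M.1 a ^ 2) := by
        refine Finset.sum_le_sum fun a _ => ?_
        rw [tildeVec_sampleFM]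
        nlinarith [sq_nonneg (smean (fun j => tildeVec (x j).1) a - 2 * tildeVec M.1 a)]
    _ ≤ 2 * R + 2 * b ^ 2 := by
        rw [Finset.sum_add_distrib, ← Finset.mul_sum, ← Finset.mul_sum, hb, frobNorm_matLog_sq]
        gcongr
        exact sum_mean_sq_le_energy hn _ _
    _ ≤ _ := by nlinarith [mul_nonneg hR0 hb0]

/-- Young's inequality, balanced so that both a fourth power and a square of the factors appear
with the right powers of `p = r ^ 4`. -/
lemma mul_le_one_add_pow_four_of_young {R K r : ℝ} (hr : 0 < r) :
    R * K ≤ 1 / r * (1 / 4 + R ^ 4 / r ^ 4 / 4 + r ^ 4 * K ^ 2 / 2) := by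
  have e : 1 / r * (1 / 4 + R ^ 4 / r ^ 4 / 4 + r ^ 4 * K ^ 2 / 2) - R * K
      = 1 / r * ((R ^ 2 / r ^ 2 - 1) ^ 2 / 4 + (R / r - r ^ 2 * K) ^ 2 / 2) := by
    field_simp
    ring
  have : 0 ≤ 1 / r * ((R ^ 2 / r ^ 2 - 1) ^ 2 / 4 + (R / r - r ^ 2 * K) ^ 2 / 2) := by positivity
  linarith

lemma le_one_add_sq_of_young {K r : ℝ} (hr : 0 < r) : K ≤ 1 / r ^ 2 * (1 + r ^ 4 * K ^ 2) := by
  have e : 1 / r ^ 2 * (1 + r ^ 4 * K ^ 2) - K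
      = 1 / r ^ 2 * ((1 - r ^ 2 * K) ^ 2 / 2 + (1 + (r ^ 2 * K) ^ 2) / 2) := by
    field_simp
    ring
  have : 0 ≤ 1 / r ^ 2 * ((1 - r ^ 2 * K) ^ 2 / 2 + (1 + (r ^ 2 * K) ^ 2) / 2) := by positivity
  linarith

/-- The two previous bounds combined: `b` stands for a bound of the `‖log M i‖`, `R` and `R'` for
energies, and `K` for a bound of the averaged statistics. -/
lemma add_mul_le_of_young {b R R' K F r : ℝ} (hr : 0 < r) (hb : 0 ≤ b) (hR : R ^ 4 / r ^ 4 ≤ F)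
    (hR' : R' ^ 4 / r ^ 4 ≤ F) :
    (1 + b + R + R') * K ≤ ((1 + b) / r ^ 2 + 1 / r) * (1 + r ^ 4 * K ^ 2 + F) := by
  have hF : 0 ≤ F := le_trans (by positivity) hR
  have h1 : (1 + b) * K ≤ (1 + b) * (1 / r ^ 2 * (1 + r ^ 4 * K ^ 2)) := by
    gcongr
    exact le_one_add_sq_of_young hr
  have h2 : R * K ≤ 1 / r * (1 / 4 + F / 4 + r ^ 4 * K ^ 2 / 2) :=
    (mul_le_one_add_pow_four_of_young hr).trans (by gcongr)
  have h3 : R' * K ≤ 1 / r * (1 / 4 + F / 4 + r ^ 4 * K ^ 2 / 2) :=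
    (mul_le_one_add_pow_four_of_young hr).trans (by gcongr)
  have h4 : 0 ≤ (1 + b) / r ^ 2 * F + 1 / r * (1 / 2 + F / 2) := by positivity
  have e : ((1 + b) / r ^ 2 + 1 / r) * (1 + r ^ 4 * K ^ 2 + F)
      = (1 + b) * (1 / r ^ 2 * (1 + r ^ 4 * K ^ 2))
        + 1 / r * (1 / 4 + F / 4 + r ^ 4 * K ^ 2 / 2) + 1 / r * (1 / 4 + F / 4 + r ^ 4 * K ^ 2 / 2)
        + ((1 + b) / r ^ 2 * F + 1 / r * (1 / 2 + F / 2)) := by ring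
  rw [e, add_mul, add_mul]
  linarith

/-- The supremum of the gap, with `p = r ^ 4` and `b` a bound for the `‖log M i‖`, is controlled by
the squares of the averaged statistics and by the fourth powers of the energies. -/
lemma exists_supGap_le (hn : 3 ≤ n) (N : ℕ) :
    ∃ D : ℝ, 0 ≤ D ∧ ∀ (p : ℕ) (x : ℕ → Fin n → SPD (Fin N)) (M : ℕ → SPD (Fin N))
      (Sig : ℕ → SPD (SymIdx N)) (b r : ℝ), 0 < p → 0 < r → r ^ 4 = p →
      (∀ i < p, frobNorm (matLog (M i).1) ≤ b) →
      supGap p x M Sig ≤ ENNReal.ofReal (D * ((1 + b) / r ^ 2 + 1 / r) *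
        (1 + p * ∑ k, avgGap p (fun i => tildeVec (M i).1) (fun i => (Sig i).1)
            (fun i j => tildeVec (x i j).1) k ^ 2
          + (p : ℝ)⁻¹ * ∑ i ∈ Finset.range p,
            energy (tildeVec (M i).1) (fun j => tildeVec (x i j).1) ^ 4)) := by
  have hn0 : n ≠ 0 := by omega
  set c : ℝ := (Fintype.card (SymIdx N) : ℝ) with hc
  have hc0 : 0 ≤ c := by positivity
  refine ⟨7 + 4 * c + c ^ 2, by positivity, ?_⟩
  intro p x M Sig b r hp hr hrp hb
  set A := avgGap p (fun i => tildeVec (M i).1) (fun i => (Sig i).1)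
    (fun i j => tildeVec (x i j).1) with hA
  set Q := ∑ k, A k ^ 2 with hQ
  set E := fun i => energy (tildeVec (M i).1) (fun j => tildeVec (x i j).1) with hE
  have hE0 : ∀ i, 0 ≤ E i := fun i => energy_nonneg _ _
  have hQ0 : 0 ≤ Q := Finset.sum_nonneg fun _ _ => sq_nonneg _
  set K := Real.sqrt Q with hKdef
  have hK0 : 0 ≤ K := Real.sqrt_nonneg _
  have hK2 : K ^ 2 = Q := Real.sq_sqrt hQ0
  have hAK : ∀ k, |A k| ≤ K := fun k => Real.abs_le_sqrt
    (Finset.single_le_sum (f := fun k => A k ^ 2) (fun _ _ => sq_nonneg _) (Finset.mem_univ k))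
  have hne : Nonempty (Fin p) := ⟨⟨0, hp⟩⟩
  have hb0 : 0 ≤ b := (frobNorm_nonneg _).trans (hb 0 hp)
  refine iSup_le fun lam => iSup_le fun Psi => iSup_le fun nu => iSup_le fun mu =>
    iSup_le fun hlam => iSup_le fun hnu => iSup_le fun hPsi => iSup_le fun hmu => ?_
  refine ENNReal.ofReal_le_ofReal ?_
  obtain ⟨i, hi⟩ := exists_eq_ciSup_of_finite (f := fun i : Fin p => frobNorm (scatter (x i)))
  obtain ⟨j, hj⟩ := exists_eq_ciSup_of_finite
    (f := fun i : Fin p => frobNorm (matLog (sampleFM (x i))))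
  have hPsiR : frobNorm Psi.1 ≤ E i :=
    hPsi.trans (hi.symm.le.trans (frobNorm_scatter_le hn0 (x i) _))
  have hmuR : frobNorm (matLog mu.1) ≤ 2 * (1 + E j + b) := by
    refine hmu.trans (hj.symm.le.trans ((frobNorm_matLog_sampleFM_le hn0 (x j) (M j)).trans ?_))
    have := hb j j.2
    simp only [hE]
    linarith
  have hsum1 : ∑ a, |tildeVec mu.1 a| ≤ c * (2 * (1 + E j + b)) := by
    calc ∑ a, |tildeVec mu.1 a| ≤ ∑ _a : SymIdx N, 2 * (1 + E j + b) :=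
          Finset.sum_le_sum fun a _ => (abs_tildeVec_le_frobNorm mu.1 a).trans hmuR
      _ = _ := by simp only [Finset.sum_const, Finset.card_univ, nsmul_eq_mul, hc]
  have hsum2 : ∑ a, ∑ b, |Psi.1 a b| ≤ c ^ 2 * E i := by
    calc ∑ a, ∑ b, |Psi.1 a b| ≤ ∑ _a : SymIdx N, ∑ _b : SymIdx N, E i :=
          Finset.sum_le_sum fun a _ => Finset.sum_le_sum fun b _ =>
            (abs_apply_le_frobNorm Psi.1 a b).trans hPsiR
      _ = _ := by simp only [Finset.sum_const, Finset.card_univ, nsmul_eq_mul, hc]; ring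
  have hE4 : ∀ i : Fin p, E i ^ 4 ≤ ∑ i ∈ Finset.range p, E i ^ 4 := fun i =>
    Finset.single_le_sum (f := fun i => E i ^ 4) (fun i _ => pow_nonneg (hE0 i) 4)
      (Finset.mem_range.2 i.2)
  have hEp : ∀ i : Fin p, E i ^ 4 / r ^ 4 ≤ (p : ℝ)⁻¹ * ∑ i ∈ Finset.range p, E i ^ 4 := by
    intro i
    rw [hrp, div_eq_inv_mul]
    exact mul_le_mul_of_nonneg_left (hE4 i) (by positivity)
  have hyoung := add_mul_le_of_young (K := K) hr hb0 (hEp i) (hEp j)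
  rw [hK2, hrp] at hyoung
  calc |sure p x lam Psi nu mu
      - totalLoss p (fun i => shrinkMean lam mu (x i)) (fun i => shrinkCov Psi nu (x i)) M Sig|
      ≤ K * (7 + 2 * ∑ a, |tildeVec mu.1 a| + ∑ a, ∑ b, |Psi.1 a b|) :=
        abs_sure_sub_totalLoss_le hn p x M Sig hlam hnu Psi mu hAK
    _ ≤ K * (7 + 2 * (c * (2 * (1 + E j + b))) + c ^ 2 * E i) := by gcongr
    _ ≤ K * ((7 + 4 * c + c ^ 2) * (1 + b + E i + E j)) := by
        refine mul_le_mul_of_nonneg_left ?_ hK0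
        have h1 := hE0 i
        have h2 := hE0 j
        have : 0 ≤ 7 * (b + E i + E j) + 4 * c * E i + c ^ 2 * (1 + b + E j) := by positivity
        linarith
    _ = (7 + 4 * c + c ^ 2) * ((1 + b + E i + E j) * K) := by ring
    _ ≤ _ := by
        rw [mul_assoc]
        exact mul_le_mul_of_nonneg_left hyoung (by positivity)

end UniformBound

/-! ### Averages over independent samples and convergence in probability -/

section Averages

variable {Ω : Type*} [MeasurableSpace Ω] {P : Measure Ω}

/-- Averages of centred pairwise independent variables: the variances add up. -/
lemma integral_average_sq_le {Z : ℕ → Ω → ℝ} (hZ : ∀ i, HasAllMoments (Z i) P)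
    (h0 : ∀ i, ∫ ω, Z i ω ∂P = 0) (hind : Pairwise fun i j => IndepFun (Z i) (Z j) P)
    {v : ℕ → ℝ} (hv : ∀ i, ∫ ω, Z i ω ^ 2 ∂P ≤ v i) (p : ℕ) :
    p * ∫ ω, ((p : ℝ)⁻¹ * ∑ i ∈ Finset.range p, Z i ω) ^ 2 ∂P
      ≤ (p : ℝ)⁻¹ * ∑ i ∈ Finset.range p, v i := by
  have hS : HasAllMoments (fun ω => ∑ i ∈ Finset.range p, Z i ω) P := .sum _ fun i _ => hZ i
  have hvar : ∫ ω, (∑ i ∈ Finset.range p, Z i ω) ^ 2 ∂P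
      = ∑ i ∈ Finset.range p, ∫ ω, Z i ω ^ 2 ∂P := by
    have h1 := IndepFun.variance_sum (s := Finset.range p) (X := Z) (μ := P)
      (fun i _ => (hZ i).memLp_two) fun i _ j _ hij => hind hij
    have e : (∑ i ∈ Finset.range p, Z i) = fun ω => ∑ i ∈ Finset.range p, Z i ω := by
      funext ω; simp
    rw [e, variance_of_integral_eq_zero hS.integrable.aemeasurable] at h1
    · rw [h1]
      exact Finset.sum_congr rfl fun i _ =>
        variance_of_integral_eq_zero (hZ i).integrable.aemeasurable (h0 i)
    · rw [integral_finsetSum _ fun i _ => (hZ i).integrable]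
      exact Finset.sum_eq_zero fun i _ => h0 i
  simp_rw [mul_pow]
  rw [integral_const_mul, hvar]
  have e : (p : ℝ) * ((p : ℝ)⁻¹ ^ 2 * ∑ i ∈ Finset.range p, ∫ ω, Z i ω ^ 2 ∂P)
      = (p : ℝ)⁻¹ * ∑ i ∈ Finset.range p, ∫ ω, Z i ω ^ 2 ∂P := by
    rcases eq_or_ne (p : ℝ) 0 with hp | hp
    · simp [hp]
    · field_simp
  rw [e]
  gcongr with i
  exact hv i

lemma exists_eventually_le_of_limsup_lt_top {f : ℕ → ℝ}
    (h : limsup (fun p => (f p : EReal)) atTop < ⊤) : ∃ C : ℝ, 0 ≤ C ∧ ∀ᶠ p in atTop, f p ≤ C := by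
  obtain ⟨c, hc, hc'⟩ := EReal.lt_iff_exists_real_btwn.1 h
  refine ⟨max c 0, le_max_right _ _, (eventually_lt_of_limsup_lt hc).mono fun p hp => ?_⟩
  exact (EReal.coe_lt_coe_iff.1 hp).le.trans (le_max_left _ _)

/-- A bounded average of `(2 + δ)`-th powers forces the maximum to be `o(√p)`. -/
lemma tendsto_max_div_sqrt {δ C : ℝ} (hδ : 0 < δ) (hC : 0 ≤ C) :
    Tendsto (fun p : ℕ => (1 + (C * p) ^ (2 + δ)⁻¹) / ((p : ℝ) ^ (1 / 4 : ℝ)) ^ 2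
      + 1 / (p : ℝ) ^ (1 / 4 : ℝ)) atTop (𝓝 0) := by
  have hpos : ∀ s : ℝ, 0 < s → Tendsto (fun p : ℕ => (p : ℝ) ^ (-s)) atTop (𝓝 0) := fun s hs =>
    (tendsto_rpow_neg_atTop hs).comp tendsto_natCast_atTop_atTop
  have hs : 0 < 1 / 2 - (2 + δ)⁻¹ := by
    rw [one_div, sub_pos]
    exact inv_strictAnti₀ two_pos (by linarith)
  have h1 := ((hpos (1 / 2) (by norm_num)).add
    ((hpos _ hs).const_mul (C ^ (2 + δ)⁻¹))).add (hpos (1 / 4) (by norm_num))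
  simp only [mul_zero, add_zero] at h1
  refine h1.congr' ?_
  filter_upwards [eventually_gt_atTop 0] with p hp
  have hp' : (0 : ℝ) < p := by exact_mod_cast hp
  have e1 : ((p : ℝ) ^ (1 / 4 : ℝ)) ^ 2 = (p : ℝ) ^ (1 / 2 : ℝ) := by
    rw [← Real.rpow_natCast, ← Real.rpow_mul hp'.le]
    norm_num
  rw [e1, Real.mul_rpow hC hp'.le, add_div, one_div ((p : ℝ) ^ (1 / 2 : ℝ)),
    one_div ((p : ℝ) ^ (1 / 4 : ℝ)), ← Real.rpow_neg hp'.le, ← Real.rpow_neg hp'.le, neg_sub,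
    Real.rpow_sub hp', mul_div_assoc]

end Averages

section LogNormalSamples

variable {Ω : Type*} [MeasurableSpace Ω] {P : Measure Ω} {N n : ℕ}
  {M : ℕ → SPD (Fin N)} {Sig : ℕ → SPD (SymIdx N)} {X : ℕ → Fin n → Ω → SPD (Fin N)}

lemma isGaussianSample_tildeVec (hlaw : ∀ i j, IsLogNormal P (X i j) (M i) (Sig i))
    (hindep : iIndepFun (fun (ij : ℕ × Fin n) => X ij.1 ij.2) P) (i : ℕ) :
    IsGaussianSample (fun j ω => tildeVec (X i j ω).1) (tildeVec (M i).1) (Sig i).1 P where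
  posDef := (Sig i).2
  law j := (hlaw i j).hasLaw
  indep := (hindep.precomp (g := fun j : Fin n => (i, j))
    fun _ _ h => (Prod.ext_iff.1 h).2).comp (fun _ => fun A => tildeVec A.1)
      fun _ => measurable_tildeVec

lemma indepFun_gapStat (hmeas : ∀ i j, Measurable (X i j))
    (hindep : iIndepFun (fun (ij : ℕ × Fin n) => X ij.1 ij.2) P) (k : GapIdx (SymIdx N)) :
    Pairwise fun i i' => IndepFun
      (fun ω => gapStat (tildeVec (M i).1) (Sig i).1 k fun j => tildeVec (X i j ω).1)
      (fun ω => gapStat (tildeVec (M i').1) (Sig i').1 k fun j => tildeVec (X i' j ω).1) P := by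
  intro i i' hii
  let S : ℕ → Finset (ℕ × Fin n) := fun i => {i} ×ˢ Finset.univ
  have hmem : ∀ i j, (i, j) ∈ S i := fun i j => by simp [S]
  have hdisj : Disjoint (S i) (S i') :=
    Finset.disjoint_product.2 (Or.inl (Finset.disjoint_singleton.2 hii))
  have hg : ∀ i, Measurable fun v : S i → SPD (Fin N) =>
      gapStat (tildeVec (M i).1) (Sig i).1 k fun j => tildeVec (v ⟨(i, j), hmem i j⟩).1 := fun i =>
    (measurable_gapStat _ _ k).comp (measurable_pi_lambda _ fun j =>
      measurable_tildeVec.comp (measurable_pi_apply _))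
  exact (hindep.indepFun_finset (S i) (S i') hdisj fun ij => hmeas ij.1 ij.2).comp (hg i) (hg i')

end LogNormalSamples

theorem theorem5 {Ω : Type*} [MeasurableSpace Ω] (P : Measure Ω) [IsProbabilityMeasure P]
    (N n : ℕ) (hn : 3 ≤ n)
    (M : ℕ → SPD (Fin N)) (Sig : ℕ → SPD (SymIdx N))
    (X : ℕ → Fin n → Ω → SPD (Fin N))
    (hlaw : ∀ i j, IsLogNormal P (X i j) (M i) (Sig i))
    (hindep : iIndepFun (fun (ij : ℕ × Fin n) => X ij.1 ij.2) P)
    (hi : limsup (fun p : ℕ =>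
      (((p : ℝ)⁻¹ * ∑ i ∈ Finset.range p, (Sig i).1.trace ^ 4 : ℝ) : EReal)) atTop < ⊤)
    (hii : limsup (fun p : ℕ =>
      (((p : ℝ)⁻¹ * ∑ i ∈ Finset.range p,
        (tildeVec (M i).1).ofLp ⬝ᵥ ((Sig i).1 *ᵥ (tildeVec (M i).1).ofLp) : ℝ) : EReal))
      atTop < ⊤)
    (hiii : ∃ δ : ℝ, 0 < δ ∧ limsup (fun p : ℕ =>
      (((p : ℝ)⁻¹ * ∑ i ∈ Finset.range p, frobNorm (matLog (M i).1) ^ (2 + δ) : ℝ) : EReal))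
      atTop < ⊤) :
    ∀ ε : ℝ, 0 < ε →
      Tendsto (fun p : ℕ => P {ω | ENNReal.ofReal ε ≤ supGap p (fun i j => X i j ω) M Sig})
        atTop (𝓝 0) := by
  intro ε hε
  have hn0 : n ≠ 0 := by omega
  obtain ⟨C₁, hC₁, h1⟩ := exists_eventually_le_of_limsup_lt_top hi
  obtain ⟨C₂, hC₂, h2⟩ := exists_eventually_le_of_limsup_lt_top hii
  obtain ⟨δ, hδ, h3⟩ := hiii
  obtain ⟨C₃, hC₃, h3⟩ := exists_eventually_le_of_limsup_lt_top h3
  obtain ⟨D, hD, hsup⟩ := exists_supGap_le hn N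
  obtain ⟨C₄, hC₄, hE4⟩ := exists_integral_energy_pow_four_le n (SymIdx N)
  obtain ⟨C₅, hC₅, hstat⟩ := exists_integral_gapStat_sq_le hn (SymIdx N)
  have hsample := isGaussianSample_tildeVec hlaw hindep
  let A : ℕ → GapIdx (SymIdx N) → Ω → ℝ := fun p k ω =>
    avgGap p (fun i => tildeVec (M i).1) (fun i => (Sig i).1) (fun i j => tildeVec (X i j ω).1) k
  let E : ℕ → Ω → ℝ := fun i ω => energy (tildeVec (M i).1) (fun j => tildeVec (X i j ω).1)
  have hA : ∀ p k, HasAllMoments (A p k) P := fun p k =>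
    (HasAllMoments.sum _ fun i _ => (hsample i).gapStat_allMoments hn0 k).const_mul _
  have hE : ∀ i, HasAllMoments (E i) P := fun i => (hE4 P _ _ _ (hsample i)).1
  let θ : ℕ → ℝ := fun p => (1 + (C₃ * p) ^ (2 + δ)⁻¹) / ((p : ℝ) ^ (1 / 4 : ℝ)) ^ 2
      + 1 / (p : ℝ) ^ (1 / 4 : ℝ)
  let T : ℕ → Ω → ℝ := fun p ω =>
    1 + p * ∑ k, A p k ω ^ 2 + (p : ℝ)⁻¹ * ∑ i ∈ Finset.range p, E i ω ^ 4
  have hsq : ∀ p, HasAllMoments (fun ω => ∑ k, A p k ω ^ 2) P := fun p =>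
    .sum _ fun k _ => (hA p k).pow 2
  have hpow : ∀ p, HasAllMoments (fun ω => ∑ i ∈ Finset.range p, E i ω ^ 4) P := fun p =>
    .sum _ fun i _ => (hE i).pow 4
  have hT : ∀ p, HasAllMoments (T p) P := fun p =>
    ((HasAllMoments.const 1).add ((hsq p).const_mul _)).add ((hpow p).const_mul _)
  set C : ℝ := 1 + Fintype.card (GapIdx (SymIdx N)) * (C₅ * (1 + C₁ + C₂)) + C₄ * C₁ with hC
  -- the expectation of the random factor stays bounded
  have hTint : ∀ᶠ p in atTop, ∫ ω, T p ω ∂P ≤ C := by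
    filter_upwards [h1, h2, eventually_gt_atTop 0] with p hp1 hp2 hp
    have hp' : (p : ℝ) ≠ 0 := by exact_mod_cast hp.ne'
    have hk : ∀ k, p * ∫ ω, A p k ω ^ 2 ∂P ≤ C₅ * (1 + C₁ + C₂) := by
      intro k
      refine (integral_average_sq_le (fun i => (hsample i).gapStat_allMoments hn0 k)
        (fun i => (hsample i).integral_gapStat hn k)
        (indepFun_gapStat (fun i j => (hlaw i j).measurable) hindep k)
        (fun i => hstat P _ _ _ (hsample i) k) p).trans ?_
      rw [← Finset.mul_sum, Finset.sum_add_distrib, Finset.sum_add_distrib, mul_left_comm]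
      refine mul_le_mul_of_nonneg_left ?_ hC₅
      rw [mul_add, mul_add]
      have : (p : ℝ)⁻¹ * ∑ _i ∈ Finset.range p, (1 : ℝ) = 1 := by simp [hp']
      linarith
    have hEi : (p : ℝ)⁻¹ * ∑ i ∈ Finset.range p, ∫ ω, E i ω ^ 4 ∂P ≤ C₄ * C₁ := by
      calc (p : ℝ)⁻¹ * ∑ i ∈ Finset.range p, ∫ ω, E i ω ^ 4 ∂P
          ≤ (p : ℝ)⁻¹ * ∑ i ∈ Finset.range p, C₄ * (Sig i).1.trace ^ 4 := by
            gcongr with i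
            exact (hE4 P _ _ _ (hsample i)).2
        _ = C₄ * ((p : ℝ)⁻¹ * ∑ i ∈ Finset.range p, (Sig i).1.trace ^ 4) := by
            rw [← Finset.mul_sum]; ring
        _ ≤ C₄ * C₁ := by gcongr
    have e : ∫ ω, T p ω ∂P = 1 + ∑ k, p * ∫ ω, A p k ω ^ 2 ∂P
        + (p : ℝ)⁻¹ * ∑ i ∈ Finset.range p, ∫ ω, E i ω ^ 4 ∂P := by
      simp only [T]
      rw [integral_add ((HasAllMoments.const 1).add ((hsq p).const_mul _)).integrable
          ((hpow p).const_mul _).integrable,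
        integral_add (integrable_const _) ((hsq p).const_mul _).integrable,
        integral_const_mul, integral_const_mul,
        integral_finsetSum _ fun k _ => ((hA p k).pow 2).integrable,
        integral_finsetSum _ fun i _ => ((hE i).pow 4).integrable, Finset.mul_sum]
      simp
    rw [e, hC]
    have hsum : ∑ k, p * ∫ ω, A p k ω ^ 2 ∂P
        ≤ Fintype.card (GapIdx (SymIdx N)) * (C₅ * (1 + C₁ + C₂)) := by
      refine (Finset.sum_le_sum fun k _ => hk k).trans ?_
      rw [Finset.sum_const, Finset.card_univ, nsmul_eq_mul]
    linarith
  -- Markov's inequality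
  have hmarkov : ∀ᶠ p in atTop,
      P {ω | ENNReal.ofReal ε ≤ supGap p (fun i j => X i j ω) M Sig}
        ≤ ENNReal.ofReal (D * θ p * C) / ENNReal.ofReal ε := by
    filter_upwards [h3, hTint, eventually_gt_atTop 0] with p hp3 hpT hp
    have hp' : (0 : ℝ) < p := by exact_mod_cast hp
    have hmax : ∀ i < p, frobNorm (matLog (M i).1) ≤ (C₃ * p) ^ (2 + δ)⁻¹ := by
      intro i hip
      have hf := frobNorm_nonneg (matLog (M i).1)
      have h4 : frobNorm (matLog (M i).1) ^ (2 + δ) ≤ C₃ * p := by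
        refine (Finset.single_le_sum (f := fun i => frobNorm (matLog (M i).1) ^ (2 + δ))
          (fun i _ => Real.rpow_nonneg (frobNorm_nonneg _) _) (Finset.mem_range.2 hip)).trans ?_
        rwa [inv_mul_le_iff₀ hp', mul_comm] at hp3
      calc frobNorm (matLog (M i).1)
          = (frobNorm (matLog (M i).1) ^ (2 + δ)) ^ (2 + δ)⁻¹ := by
            rw [← Real.rpow_mul hf, mul_inv_cancel₀ (by linarith), Real.rpow_one]
        _ ≤ _ := Real.rpow_le_rpow (Real.rpow_nonneg hf _) h4 (by positivity)
    have hr : ((p : ℝ) ^ (1 / 4 : ℝ)) ^ 4 = p := by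
      rw [← Real.rpow_natCast, ← Real.rpow_mul hp'.le]
      norm_num
    have hθ : 0 ≤ θ p := by simp only [θ]; positivity
    have hle : ∀ ω, supGap p (fun i j => X i j ω) M Sig ≤ ENNReal.ofReal (D * θ p * T p ω) :=
      fun ω => hsup p (fun i j => X i j ω) M Sig _ _ hp (Real.rpow_pos_of_pos hp' _) hr hmax
    have hT0 : ∀ ω, 0 ≤ T p ω := fun ω => by
      have : 0 ≤ ∑ i ∈ Finset.range p, E i ω ^ 4 :=
        Finset.sum_nonneg fun i _ => pow_nonneg (energy_nonneg _ _) 4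
      simp only [T]
      positivity
    have hint : Integrable (fun ω => D * θ p * T p ω) P := ((hT p).const_mul _).integrable
    calc P {ω | ENNReal.ofReal ε ≤ supGap p (fun i j => X i j ω) M Sig}
        ≤ P {ω | ENNReal.ofReal ε ≤ ENNReal.ofReal (D * θ p * T p ω)} :=
          measure_mono fun ω hω => le_trans hω (hle ω)
      _ ≤ (∫⁻ ω, ENNReal.ofReal (D * θ p * T p ω) ∂P) / ENNReal.ofReal ε :=
          meas_ge_le_lintegral_div hint.aemeasurable.ennreal_ofReal
            (by simpa using hε) ENNReal.ofReal_ne_top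
      _ = ENNReal.ofReal (D * θ p * ∫ ω, T p ω ∂P) / ENNReal.ofReal ε := by
          rw [← ofReal_integral_eq_lintegral_ofReal hint
            (Eventually.of_forall fun ω => mul_nonneg (mul_nonneg hD hθ) (hT0 ω)),
            integral_const_mul]
      _ ≤ _ := by gcongr
  have hlim : Tendsto (fun p => ENNReal.ofReal (D * θ p * C) / ENNReal.ofReal ε) atTop (𝓝 0) := by
    have h5 : Tendsto (fun p => D * θ p * C) atTop (𝓝 0) := by
      have := ((tendsto_max_div_sqrt hδ hC₃).const_mul D).mul_const C
      rwa [mul_zero, zero_mul] at this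
    have h6 := ENNReal.Tendsto.div_const (ENNReal.tendsto_ofReal h5)
      (b := ENNReal.ofReal ε) (Or.inr (by simpa using hε))
    simpa using h6
  exact tendsto_of_tendsto_of_tendsto_of_le_of_le' tendsto_const_nhds hlim
    (Eventually.of_forall fun _ => zero_le) hmarkov
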